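/- Let $q$ be a prime power with $q\equiv 1\pmod 4$, $A=\mathbb F_q[T]$, $F=\mathbb F_q(T)$, $F^{\rm sep}$ a separable closure of $F$, and let $\varphi$ be the Drinfeld $A$-module of rank $2$ over $F$ with $$\varphi_T = T+\tau-T^{q-1}\tau^2,\qquad \tau(x)=x^q .$$ For each nonzero prime ideal $\lambda$ of $A$, let $\rho_{\varphi,\lambda}$ be the representation of $\operatorname{Gal}(F^{\rm sep}/F)$ on the $\lambda$-adic Tate module $\varprojlim_i \varphi[\lambda^i]$ over the completion $A_\lambda$. For an irreducible polynomial $\mathfrak p\in A$ with $(\mathfrak p)\ne(T)$, let $a_{\mathfrak p}(\varphi)\in A$ be the trace of Frobenius, i.e. the element of $A$ equal to $\operatorname{tr}\rho_{\varphi,\lambda}(\operatorname{Frob}_{\mathfrak p})$ in $A_\lambda$ for every $\lambda\neq(\mathfrak p)$ and every arithmetic Frobenius element $\operatorname{Frob}_{\mathfrak p}$ at $\mathfrak p$. **Proposition.** Let $n$ be an even integer and let $\mathfrak p\in A$ be an irreducible polynomial of degree $n$ with $(\mathfrak p)\ne(T)$. Then $a_{\mathfrak p}(\varphi)$ is well defined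 (there is exactly one such element of $A$) and it has degree exactly $n/2$. Consequently, for every $t\in A$ and every even integer $n$ with $n>2\deg t$ (any even $n>0$ if $t=0$), there is no monic irreducible polynomial $\mathfrak p\neq T$ of degree $n$ with $a_{\mathfrak p}(\varphi)=t$. -/

import Mathlib

open Polynomial

noncomputable section

/-! ## Tate modules

For a module `M` over a commutative ring `R` and `ϖ : R`, the `ϖ`-adic Tate module of `M` is the
inverse limit of the torsion submodules `M[ϖ ^ n]` along multiplication by `ϖ`.  It is a module
over the `ϖ`-adic completion of `R`. -/

section Tate

variable {R : Type*} [CommRing R] {M : Type*} [AddCommGroup M] [Module R M]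

/-- The Tate module `lim M[ϖ ^ n]`: sequences `x` with `x 0 = 0` and `ϖ • x (n + 1) = x n`
(so that automatically `ϖ ^ n • x n = 0`). -/
def tateModule (ϖ : R) (M : Type*) [AddCommGroup M] [Module R M] : Submodule R (ℕ → M) where
  carrier := {x | x 0 = 0 ∧ ∀ n, ϖ • x (n + 1) = x n}
  add_mem' := by
    rintro x y ⟨hx, hx'⟩ ⟨hy, hy'⟩
    exact ⟨by simp [hx, hy], fun n => by simp [smul_add, hx', hy']⟩
  zero_mem' := ⟨rfl, fun n => by simp⟩
  smul_mem' := by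
    rintro c x ⟨hx, hx'⟩
    exact ⟨by simp [hx], fun n => by simp [smul_comm ϖ c, hx']⟩

/-- The completion of `R` at the ideal generated by `ϖ`. -/
abbrev completionAt (ϖ : R) : Type _ := AdicCompletion (Ideal.span {ϖ}) R

theorem tateModule_pow_smul {ϖ : R} (x : tateModule ϖ M) (n : ℕ) : ϖ ^ n • x.1 n = 0 := by
  induction n with
  | zero => simpa using x.2.1
  | succ n ih => rw [pow_succ, mul_smul, x.2.2 n, ih]

theorem tateModule_smul_eq {ϖ : R} (x : tateModule ϖ M) (n : ℕ) {r s : R}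
    (h : Ideal.Quotient.mk (Ideal.span {ϖ} ^ n) r = Ideal.Quotient.mk (Ideal.span {ϖ} ^ n) s) :
    r • x.1 n = s • x.1 n := by
  rw [Ideal.Quotient.eq, Ideal.span_singleton_pow, Ideal.mem_span_singleton] at h
  obtain ⟨c, hc⟩ := h
  rw [← sub_eq_zero, ← sub_smul, hc, mul_comm, mul_smul, tateModule_pow_smul, smul_zero]

/-- A representative in `R` of the image of `a` in `R ⧸ (ϖ) ^ n`. -/
def completionRep {ϖ : R} (a : completionAt ϖ) (n : ℕ) : R :=
  Quotient.out (AdicCompletion.evalₐ (Ideal.span {ϖ}) n a)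

theorem mk_completionRep {ϖ : R} (a : completionAt ϖ) (n : ℕ) :
    Ideal.Quotient.mk (Ideal.span {ϖ} ^ n) (completionRep a n) =
      AdicCompletion.evalₐ (Ideal.span {ϖ}) n a :=
  Quotient.out_eq _

theorem mk_completionRep_succ {ϖ : R} (a : completionAt ϖ) (n : ℕ) :
    Ideal.Quotient.mk (Ideal.span {ϖ} ^ n) (completionRep a (n + 1)) =
      AdicCompletion.evalₐ (Ideal.span {ϖ}) n a := by
  have h := congrArg (Ideal.Quotient.factor (Ideal.pow_le_pow_right (Nat.le_succ n)))
    (mk_completionRep a (n + 1))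
  rw [Ideal.Quotient.factor_mk] at h
  rw [h]
  obtain ⟨b, rfl⟩ := AdicCompletion.mk_surjective _ _ a
  rw [AdicCompletion.evalₐ_mk, AdicCompletion.evalₐ_mk, Ideal.Quotient.factor_mk]
  have := b.2 (Nat.le_succ n)
  rw [SModEq.sub_mem] at this
  rw [Ideal.Quotient.eq, ← neg_mem_iff, neg_sub]
  simpa using this

/-- `a` in the completion acts on the `n`-th entry, which is killed by `ϖ ^ n`, through the image of
`a` in `R ⧸ (ϖ) ^ n`. -/
instance tateModule.instSMul (ϖ : R) : SMul (completionAt ϖ) (tateModule ϖ M) where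
  smul a x := ⟨fun n => completionRep a n • x.1 n, by simp [x.2.1], fun n => by
    rw [smul_comm, x.2.2 n]
    have h := tateModule_smul_eq x n ((mk_completionRep_succ a n).trans (mk_completionRep a n).symm)
    exact h⟩

/-- The action can be computed with any representative. -/
theorem tateModule.smul_apply {ϖ : R} (a : completionAt ϖ) (x : tateModule ϖ M) (n : ℕ) {r : R}
    (hr : Ideal.Quotient.mk (Ideal.span {ϖ} ^ n) r =
      AdicCompletion.evalₐ (Ideal.span {ϖ}) n a) :
    (a • x).1 n = r • x.1 n :=
  tateModule_smul_eq x n ((mk_completionRep a n).trans hr.symm)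

instance tateModule.instModule (ϖ : R) : Module (completionAt ϖ) (tateModule ϖ M) where
  one_smul x := by
    ext n
    rw [tateModule.smul_apply 1 x n (r := 1) (by simp), one_smul]
  mul_smul a b x := by
    ext n
    rw [tateModule.smul_apply (a * b) x n (r := completionRep a n * completionRep b n)
      (by simp [mk_completionRep]), mul_smul]
    rfl
  smul_zero a := by
    ext n
    exact smul_zero _
  smul_add a x y := by
    ext n
    exact smul_add _ _ _
  add_smul a b x := by
    ext n
    rw [tateModule.smul_apply (a + b) x n (r := completionRep a n + completionRep b n)
      (by simp [mk_completionRep]), add_smul]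
    rfl
  zero_smul x := by
    ext n
    rw [tateModule.smul_apply 0 x n (r := 0) (by simp), zero_smul]
    rfl

/-- The action of linear endomorphisms of `M` on the Tate module of `M`. -/
def tateEnd (ϖ : R) (M : Type*) [AddCommGroup M] [Module R M] :
    Module.End R M →* Module.End (completionAt ϖ) (tateModule ϖ M) where
  toFun f :=
    { toFun := fun x => ⟨fun n => f (x.1 n), by simp [x.2.1], fun n => by
        rw [← map_smul, x.2.2 n]⟩
      map_add' := fun x y => by
        ext n
        exact map_add f _ _
      map_smul' := fun a x => by
        ext n
        exact map_smul f _ _ }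
  map_one' := rfl
  map_mul' _ _ := rfl

end Tate

/-! ## The Drinfeld module `φ` -/

section Drinfeld

variable (k : Type*) [Field k] [Fintype k]

/-- A separable closure of the rational function field `F = k(T)`. -/
def Fsep : Type _ := SeparableClosure (RatFunc k)

instance Fsep.instField : Field (Fsep k) := inferInstanceAs (Field (SeparableClosure (RatFunc k)))

instance Fsep.instAlgebraRatFunc : Algebra (RatFunc k) (Fsep k) :=
  inferInstanceAs (Algebra (RatFunc k) (SeparableClosure (RatFunc k)))

instance Fsep.instIsSepClosure : IsSepClosure (RatFunc k) (Fsep k) :=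
  inferInstanceAs (IsSepClosure (RatFunc k) (SeparableClosure (RatFunc k)))

instance Fsep.instIsAlgebraic : Algebra.IsAlgebraic (RatFunc k) (Fsep k) :=
  inferInstanceAs (Algebra.IsAlgebraic (RatFunc k) (SeparableClosure (RatFunc k)))

instance Fsep.instAlgebraPolynomial : Algebra k[X] (Fsep k) :=
  ((algebraMap (RatFunc k) (Fsep k)).comp (algebraMap k[X] (RatFunc k))).toAlgebra

instance Fsep.instAlgebraBase : Algebra k (Fsep k) :=
  ((algebraMap (RatFunc k) (Fsep k)).comp (algebraMap k (RatFunc k))).toAlgebra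

instance Fsep.instTowerPolynomial : IsScalarTower k[X] (RatFunc k) (Fsep k) :=
  IsScalarTower.of_algebraMap_eq fun _ => rfl

instance Fsep.instTowerBase : IsScalarTower k (RatFunc k) (Fsep k) :=
  IsScalarTower.of_algebraMap_eq fun _ => rfl

instance Fsep.instTowerBasePolynomial : IsScalarTower k k[X] (Fsep k) :=
  IsScalarTower.of_algebraMap_eq fun x =>
    congrArg (algebraMap (RatFunc k) (Fsep k)) (IsScalarTower.algebraMap_apply k k[X] (RatFunc k) x)

/-- The indeterminate `T`, as an element of the separable closure of `k(T)`. -/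
def sepT : Fsep k := algebraMap (RatFunc k) (Fsep k) RatFunc.X

/-- The `q`-power Frobenius `τ`, as a `k`-linear endomorphism, where `q = #k`. -/
def tau : Module.End k (Fsep k) := (FiniteField.frobeniusAlgHom k (Fsep k)).toLinearMap

/-- The endomorphism `φ_T = T + τ - T ^ (q - 1) τ ^ 2` of the separable closure of `k(T)`; that is,
`x ↦ T x + x ^ q - T ^ (q - 1) x ^ (q ^ 2)`. -/
def drinfeldT : Module.End k (Fsep k) :=
  LinearMap.mulLeft k (sepT k) + tau k -
    LinearMap.mulLeft k (sepT k ^ (Fintype.card k - 1)) * tau k ^ 2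

theorem drinfeldT_apply (x : Fsep k) :
    drinfeldT k x = sepT k * x + x ^ Fintype.card k -
      sepT k ^ (Fintype.card k - 1) * x ^ (Fintype.card k ^ 2) := by
  simp [drinfeldT, tau, pow_two, pow_mul]

/-- The additive group of the separable closure of `F = k(T)` with the `k[T]`-module structure given
by the Drinfeld module `φ`, i.e. `a • x = φ_a(x)`, where `a ↦ φ_a` is the `k`-algebra homomorphism
with `φ_T = T + τ - T ^ (q - 1) τ ^ 2`. -/
abbrev drinfeldPoints : Type _ := Module.AEval' (drinfeldT k)

theorem galois_drinfeldT (σ : Gal(Fsep k/RatFunc k)) (x : Fsep k) :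
    σ (drinfeldT k x) = drinfeldT k (σ x) := by
  have hT : σ (sepT k) = sepT k := σ.commutes _
  simp [drinfeldT_apply, hT]

/-- The action of the absolute Galois group of `k(T)` on the points of `φ`, by `k[T]`-linear
endomorphisms. -/
def galoisPoints : Gal(Fsep k/RatFunc k) →* Module.End k[X] (drinfeldPoints k) where
  toFun σ := LinearMap.ofAEval (drinfeldT k)
    ((Module.AEval'.of (drinfeldT k)).toLinearMap ∘ₗ
      (σ.toAlgHom.restrictScalars k).toLinearMap) (fun x => by
        have h : σ (drinfeldT k x) = drinfeldT k (σ x) := galois_drinfeldT k σ x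
        simpa [h] using (Module.AEval'.X_smul_of (drinfeldT k) (σ x)).symm)
  map_one' := rfl
  map_mul' _ _ := rfl

/-- The `λ`-adic Galois representation `ρ_{φ, λ}` on the Tate module of `φ`, where `λ` is the prime
ideal generated by the irreducible polynomial `ϖ`. -/
def adicRep (ϖ : k[X]) : Representation (completionAt ϖ) (Gal(Fsep k/RatFunc k))
    (tateModule ϖ (drinfeldPoints k)) :=
  (tateEnd ϖ (drinfeldPoints k)).comp (galoisPoints k)

variable {k}

/-- `σ` is an (arithmetic) Frobenius element at the ideal `(𝔭)` of `k[T]`: there is a prime `Q` above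
`𝔭` of the integral closure of `k[T]` in the separable closure of `k(T)`, such that
`σ x ≡ x ^ #(k[T] ⧸ 𝔭) (mod Q)` for all integral `x`.  Such `σ` exist for all `𝔭`; they form a
union of cosets of the inertia groups of the primes above `𝔭`. -/
def IsFrobenius (𝔭 : k[X]) (σ : Gal(Fsep k/RatFunc k)) : Prop :=
  ∃ Q : Ideal (integralClosure k[X] (Fsep k)), Q.IsPrime ∧ Q.LiesOver (Ideal.span {𝔭}) ∧
    AlgHom.IsArithFrobAt
      (galRestrict k[X] (RatFunc k) (Fsep k) (integralClosure k[X] (Fsep k)) σ).toAlgHom Q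

/-- `a` is the trace of Frobenius of `φ` at `𝔭`: for all primes `λ = (ϖ)` other than `(𝔭)` and all
Frobenius elements `σ` at `𝔭`, the trace of `ρ_{φ, λ}(σ)` is equal to `a`. -/
def IsFrobeniusTrace (𝔭 a : k[X]) : Prop :=
  ∀ ϖ : k[X], Irreducible ϖ → ¬ Associated ϖ 𝔭 → ∀ σ, IsFrobenius 𝔭 σ →
    LinearMap.trace (completionAt ϖ) (tateModule ϖ (drinfeldPoints k)) (adicRep k ϖ σ) =
      algebraMap k[X] (completionAt ϖ) a

open Classical in
/-- The trace of Frobenius `a_𝔭(φ)` in `k[T]` (and `0` if there is none). -/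
def frobeniusTrace (𝔭 : k[X]) : k[X] :=
  if h : ∃ a, IsFrobeniusTrace 𝔭 a then h.choose else 0

/-- The number of monic irreducible polynomials `𝔭 ≠ T` of degree `n` with `a_𝔭(φ) = t`
(`φ` has good reduction at all primes but `(T)`). -/
def langTrotterCount (t : k[X]) (n : ℕ) : ℕ∞ :=
  {𝔭 : k[X] | 𝔭.Monic ∧ Irreducible 𝔭 ∧ 𝔭 ≠ X ∧ 𝔭.natDegree = n ∧
    frobeniusTrace 𝔭 = t}.encard

end Drinfeld

end

/-! Let L be the residue field of `𝔭`, let t be the image of T, and let n = deg `𝔭`. The skew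
polynomials in τ over L form a free L[X]-module on 1, τ, where L multiplies on the left and X acts
as right multiplication by φ_T. On this basis τ ^ n is described by `frobMat k t n`, a product of n
one-step matrices. Twisting its coefficients by the q-Frobenius conjugates it, so its trace a and
determinant b lie in k[X], and Cayley–Hamilton gives π² - φ_a π + φ_b = 0 for π = τ ^ n
(`frobenius_relation`).

For n = 2m, every two steps raise the degree by one (`coeff_frobMat`). Up to sign, the coefficient
of X ^ m in a is w⁻¹ + w^(-q), where w = s ^ (q - 1) and s is the norm of t to the field with q²
elements. If it vanished then w² = -1, hence w ^ q = w because q ≡ 1 mod 4, and so 2w = 0,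
impossible in odd characteristic (`prod_add_prod_ne_zero`). So deg a = m.

To reach the Galois action, note that torsion points of φ are integral away from T, and that torsion
prime to `𝔭` injects under reduction at a prime above `𝔭`. A Frobenius element therefore satisfies
the same quadratic relation on each Tate module (`galois_relation`), which is free of rank 2 over a
domain. Such an endomorphism has trace a or is a scalar (`trace_eq_or_scalar`); counting roots
excludes scalars (`galois_not_scalar`). Frobenius elements exist (`exists_isFrobenius`), so the
traces determine a. -/

noncomputable section

universe u

set_option linter.unusedSectionVars false

/-! ### The operator φ_T over a general base: linear terms, degrees and torsion counts. -/

section Operator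

variable {k : Type*} [Field k] [Fintype k] {B B' : Type*} [CommRing B] [Algebra k B]
  [CommRing B'] [Algebra k B']

variable (k) in
/-- The operator `x ↦ t x + x ^ q - t ^ (q - 1) x ^ (q ^ 2)` on a commutative `k`-algebra. -/
def drinfeldOp (t : B) : Module.End k B :=
  LinearMap.mulLeft k t + (FiniteField.frobeniusAlgHom k B).toLinearMap -
    LinearMap.mulLeft k (t ^ (Fintype.card k - 1)) *
      (FiniteField.frobeniusAlgHom k B).toLinearMap ^ 2

theorem drinfeldOp_apply (t x : B) :
    drinfeldOp k t x = t * x + x ^ Fintype.card k -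
      t ^ (Fintype.card k - 1) * x ^ (Fintype.card k ^ 2) := by
  simp [drinfeldOp, pow_two, pow_mul]

/-- Naturality of φ_f in the base. It serves for evaluation maps, powers of Frobenius, Galois
automorphisms, and the inclusion and projections of the reduction graph. -/
theorem map_aeval_drinfeldOp (h : B →ₐ[k] B') (t : B) (f : k[X]) (x : B) :
    h (aeval (drinfeldOp k t) f x) = aeval (drinfeldOp k (h t)) f (h x) := by
  induction f using Polynomial.induction_on' generalizing x with
  | add p r hp hr => simp [hp, hr]
  | monomial n a =>
    simp only [aeval_monomial, Module.algebraMap_end_eq_smul_id, Module.End.mul_apply,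
      LinearMap.smul_apply, LinearMap.id_apply, map_smul]
    congr 1
    induction n generalizing x with
    | zero => simp
    | succ n ih =>
      rw [pow_succ, Module.End.mul_apply, ih, pow_succ, Module.End.mul_apply]
      simp [drinfeldOp_apply]

/-- Apart from the linear term, φ_f only involves powers of x with exponent at least q ≥ 2. This
makes reduction injective on torsion. -/
theorem exists_aeval_drinfeldOp_eq (t : B) (f : k[X]) (x : B) :
    ∃ s, aeval (drinfeldOp k t) f x = aeval t f * x + x ^ 2 * s := by
  have hq : 2 ≤ Fintype.card k := Fintype.one_lt_card
  induction f using Polynomial.induction_on with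
  | C a => exact ⟨0, by simp [Algebra.smul_def]⟩
  | add p r hp hr =>
    obtain ⟨s, hs⟩ := hp
    obtain ⟨u, hu⟩ := hr
    exact ⟨s + u, by simp [hs, hu]; ring⟩
  | monomial n a h =>
    obtain ⟨s, hs⟩ := h
    rw [pow_succ', mul_left_comm, map_mul, Module.End.mul_apply, hs, aeval_X, drinfeldOp_apply]
    have hd : ∀ m, 2 ≤ m → x ^ 2 ∣ (aeval t (C a * X ^ n) * x + x ^ 2 * s) ^ m := fun m hm =>
      (pow_dvd_pow x hm).trans (pow_dvd_pow_of_dvd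
        (dvd_add (dvd_mul_left _ _) ((dvd_pow_self x two_ne_zero).mul_right _)) _)
    obtain ⟨u, hu⟩ := hd _ hq
    obtain ⟨v, hv⟩ := hd (Fintype.card k ^ 2) (hq.trans (Nat.le_self_pow two_ne_zero _))
    rw [hu, hv]
    exact ⟨t * s + u - t ^ (Fintype.card k - 1) * v, by simp; ring⟩

variable (k) in
/-- The polynomial `φ_f(X)`, for the operator `drinfeldOp k t`. -/
def drinfeldPoly (t : B) (f : k[X]) : B[X] :=
  aeval (drinfeldOp k (C t)) f X

theorem aeval_drinfeldPoly [Algebra B B'] [IsScalarTower k B B'] (t : B) (f : k[X]) (x : B') :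
    aeval x (drinfeldPoly k t f) = aeval (drinfeldOp k (algebraMap B B' t)) f x := by
  have := map_aeval_drinfeldOp ((aeval (R := B) x).restrictScalars k) (C t) f X
  simpa [drinfeldPoly] using this

theorem eval_drinfeldPoly (t : B) (f : k[X]) (x : B) :
    eval x (drinfeldPoly k t f) = aeval (drinfeldOp k t) f x := by
  rw [← coe_aeval_eq_eval, aeval_drinfeldPoly]; rfl

theorem card_cast_eq_zero : ((Fintype.card k : ℕ) : B) = 0 := by
  rw [← map_natCast (algebraMap k B), FiniteField.cast_card_eq_zero, map_zero]

theorem derivative_drinfeldPoly (t : B) (f : k[X]) :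
    derivative (drinfeldPoly k t f) = C (aeval t f) := by
  unfold drinfeldPoly
  induction f using Polynomial.induction_on with
  | C a => simp [Algebra.smul_def, Polynomial.algebraMap_apply]
  | add p r hp hr => simp [hp, hr]
  | monomial n a h =>
    rw [pow_succ', mul_left_comm, map_mul, Module.End.mul_apply, aeval_X, drinfeldOp_apply, ← C_pow]
    simp only [derivative_mul, derivative_add, derivative_sub, derivative_C, derivative_pow, h]
    simp [card_cast_eq_zero]

theorem natDegree_drinfeldOp [IsDomain B] {t : B} (ht : t ≠ 0) {p : B[X]} (hp : 0 < p.natDegree) :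
    (drinfeldOp k (C t) p).natDegree = Fintype.card k ^ 2 * p.natDegree ∧
      (drinfeldOp k (C t) p).leadingCoeff =
        -t ^ (Fintype.card k - 1) * p.leadingCoeff ^ Fintype.card k ^ 2 := by
  have hq : 1 < Fintype.card k := Fintype.one_lt_card
  set q := Fintype.card k
  have hlow : (C t * p + p ^ q).natDegree < q ^ 2 * p.natDegree := by
    refine (natDegree_add_le _ _).trans_lt (max_lt ?_ ?_)
    · rw [natDegree_C_mul ht]
      exact lt_mul_of_one_lt_left hp (Nat.one_lt_pow two_ne_zero hq)
    · rw [natDegree_pow, pow_two]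
      nlinarith [Nat.mul_pos (zero_lt_one.trans hq) hp]
  have hc : -t ^ (q - 1) ≠ 0 := neg_ne_zero.2 (pow_ne_zero _ ht)
  have htop : (C (-t ^ (q - 1)) * p ^ q ^ 2).natDegree = q ^ 2 * p.natDegree := by
    rw [natDegree_C_mul hc, natDegree_pow]
  have h : drinfeldOp k (C t) p = C t * p + p ^ q + C (-t ^ (q - 1)) * p ^ q ^ 2 := by
    rw [drinfeldOp_apply, C_neg, C_pow]
    ring
  rw [h]
  constructor
  · rw [natDegree_add_eq_right_of_natDegree_lt (by rwa [htop]), htop]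
  · rw [leadingCoeff_add_of_degree_lt (degree_lt_degree (by rwa [htop])), leadingCoeff_mul,
      leadingCoeff_C, leadingCoeff_pow]

/-- The shape of the leading coefficient matters: it is a unit once t is inverted, which makes
torsion points integral away from T. -/
theorem natDegree_drinfeldOp_pow_X [IsDomain B] {t : B} (ht : t ≠ 0) (n : ℕ) :
    (((drinfeldOp k (C t)) ^ n) X).natDegree = Fintype.card k ^ (2 * n) ∧
      ∃ e m : ℕ, (((drinfeldOp k (C t)) ^ n) X).leadingCoeff = (-1) ^ e * t ^ m := by
  induction n with
  | zero => exact ⟨by simp, 0, 0, by simp⟩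
  | succ n ih =>
    obtain ⟨h1, e, m, h2⟩ := ih
    obtain ⟨h3, h4⟩ := natDegree_drinfeldOp (k := k) ht
      (p := ((drinfeldOp k (C t)) ^ n) X) (h1 ▸ pow_pos Fintype.card_pos _)
    rw [pow_succ', Module.End.mul_apply]
    refine ⟨by rw [h3, h1]; ring, 1 + e * Fintype.card k ^ 2,
      (Fintype.card k - 1) + m * Fintype.card k ^ 2, ?_⟩
    rw [h4, h2]
    ring

theorem degree_drinfeldPoly_lt [IsDomain B] {t : B} (ht : t ≠ 0) {f : k[X]} {d : ℕ}
    (hf : f.degree < d) : (drinfeldPoly k t f).degree < (Fintype.card k ^ (2 * d) : ℕ) := by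
  rcases eq_or_ne f 0 with rfl | h0
  · rw [drinfeldPoly, map_zero, LinearMap.zero_apply, degree_zero]
    exact WithBot.bot_lt_coe _
  rw [degree_eq_natDegree h0, Nat.cast_lt] at hf
  rw [drinfeldPoly, aeval_eq_sum_range, LinearMap.sum_apply]
  refine (degree_sum_le _ _).trans_lt ((Finset.sup_lt_iff (WithBot.bot_lt_coe _)).2 fun i hi => ?_)
  rw [LinearMap.smul_apply]
  refine (degree_smul_le _ _).trans_lt (degree_le_natDegree.trans_lt ?_)
  rw [(natDegree_drinfeldOp_pow_X ht i).1, Nat.cast_lt]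
  have := Finset.mem_range.1 hi
  exact Nat.pow_lt_pow_right Fintype.one_lt_card (by omega)

theorem natDegree_drinfeldPoly [IsDomain B] {t : B} (ht : t ≠ 0) {f : k[X]} (hf : f ≠ 0) :
    (drinfeldPoly k t f).natDegree = Fintype.card k ^ (2 * f.natDegree) ∧
      ∃ e m : ℕ, (drinfeldPoly k t f).leadingCoeff =
        algebraMap k B f.leadingCoeff * ((-1) ^ e * t ^ m) := by
  obtain ⟨h1, e, m, h2⟩ := natDegree_drinfeldOp_pow_X (k := k) ht f.natDegree
  set p := ((drinfeldOp k (C t)) ^ f.natDegree) X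
  have h : drinfeldPoly k t f =
      drinfeldPoly k t f.eraseLead + C (algebraMap k B f.leadingCoeff) * p := by
    conv_lhs => rw [← eraseLead_add_monomial_natDegree_leadingCoeff f]
    rw [drinfeldPoly, map_add, LinearMap.add_apply, aeval_monomial,
      Module.algebraMap_end_eq_smul_id, Module.End.mul_apply, LinearMap.smul_apply,
      LinearMap.id_apply, Algebra.smul_def, Polynomial.algebraMap_apply]
    rfl
  have hc : algebraMap k B f.leadingCoeff ≠ 0 := by simpa using hf
  have hp : p ≠ 0 := by
    rintro hp
    rw [hp] at h1
    exact (pow_pos Fintype.card_pos _).ne h1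
  have hd : (C (algebraMap k B f.leadingCoeff) * p).degree =
      (Fintype.card k ^ (2 * f.natDegree) : ℕ) := by
    rw [degree_C_mul hc, degree_eq_natDegree hp, h1]
  have hlt : (drinfeldPoly k t f.eraseLead).degree <
      (C (algebraMap k B f.leadingCoeff) * p).degree := by
    rw [hd]
    exact degree_drinfeldPoly_lt ht ((degree_eraseLead_lt hf).trans_eq (degree_eq_natDegree hf))
  rw [h]
  constructor
  · rw [natDegree, degree_add_eq_right_of_degree_lt hlt, hd]
    rfl
  · refine ⟨e, m, ?_⟩
    rw [leadingCoeff_add_of_degree_lt hlt, leadingCoeff_mul, leadingCoeff_C, h2]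

section SepClosed

variable {K : Type*} [Field K] [Algebra k K]

/-- The derivative is the nonzero constant f(t), so it alone provides the Bézout identity. -/
theorem separable_drinfeldPoly_sub_C {t : K} {f : k[X]} (hf : aeval t f ≠ 0) (y : K) :
    (drinfeldPoly k t f - C y).Separable := by
  refine ⟨0, C (aeval t f)⁻¹, ?_⟩
  rw [derivative_sub, derivative_drinfeldPoly, derivative_C, sub_zero, ← C_mul, inv_mul_cancel₀ hf]
  simp

theorem aeval_drinfeldOp_surjective [IsSepClosed K] {t : K} (ht : t ≠ 0) {f : k[X]}
    (hf : aeval t f ≠ 0) : Function.Surjective (aeval (drinfeldOp k t) f) := by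
  intro y
  have hf0 : f ≠ 0 := by rintro rfl; simp at hf
  obtain ⟨x, hx⟩ := IsSepClosed.exists_root (drinfeldPoly k t f - C y) (by
    intro h
    have h' := natDegree_eq_of_degree_eq_some h
    rw [natDegree_sub_C, (natDegree_drinfeldPoly ht hf0).1] at h'
    exact (pow_pos Fintype.card_pos _).ne' h') (separable_drinfeldPoly_sub_C hf y)
  refine ⟨x, ?_⟩
  rw [← eval_drinfeldPoly]
  simpa [sub_eq_zero] using hx

theorem ncard_ker_aeval_drinfeldOp [IsSepClosed K] {t : K} (ht : t ≠ 0) {f : k[X]}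
    (hf : aeval t f ≠ 0) :
    {x | aeval (drinfeldOp k t) f x = 0}.ncard = Fintype.card k ^ (2 * f.natDegree) := by
  classical
  have hf0 : f ≠ 0 := by rintro rfl; simp at hf
  have hsep : (drinfeldPoly k t f).Separable := by
    simpa using separable_drinfeldPoly_sub_C hf 0
  have h : {x | aeval (drinfeldOp k t) f x = 0} = (drinfeldPoly k t f).rootSet K := by
    ext x
    rw [mem_rootSet_of_ne hsep.ne_zero, coe_aeval_eq_eval, eval_drinfeldPoly]
    rfl
  rw [h, ← Nat.card_coe_set_eq, Nat.card_eq_fintype_card,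
    card_rootSet_eq_natDegree hsep (IsSepClosed.splits_domain _ hsep), (natDegree_drinfeldPoly ht hf0).1]

end SepClosed

end Operator

/-! ### Tate modules of divisible modules are free over the completion, which is a domain. -/

section TateBasis

variable {R : Type*} [CommRing R] {M : Type*} [AddCommGroup M] [Module R M]

theorem mk_span_pow_eq_iff {ϖ r s : R} {n : ℕ} :
    Ideal.Quotient.mk (Ideal.span {ϖ} ^ n) r = Ideal.Quotient.mk (Ideal.span {ϖ} ^ n) s ↔
      ϖ ^ n ∣ r - s := by
  rw [Ideal.Quotient.eq, Ideal.span_singleton_pow, Ideal.mem_span_singleton]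

theorem exists_completion_of_compatible {ϖ : R} (r : ℕ → R) (hr : ∀ n, ϖ ^ n ∣ r (n + 1) - r n) :
    ∃ c : completionAt ϖ, ∀ n, Ideal.Quotient.mk (Ideal.span {ϖ} ^ n) (r n) =
      AdicCompletion.evalₐ (Ideal.span {ϖ}) n c := by
  refine ⟨AdicCompletion.mk _ _ (AdicCompletion.AdicCauchySequence.mk _ _ r fun n => ?_),
    fun n => by rw [AdicCompletion.evalₐ_mk]; rfl⟩
  rw [SModEq.sub_mem, smul_eq_mul, Ideal.mul_top, Ideal.span_singleton_pow,
    Ideal.mem_span_singleton, ← dvd_neg, neg_sub]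
  exact hr n

theorem completion_eq_zero_iff {ϖ : R} (c : completionAt ϖ) :
    c = 0 ↔ ∀ n, ϖ ^ n ∣ completionRep c n := by
  have h : ∀ n, ϖ ^ n ∣ completionRep c n ↔ AdicCompletion.evalₐ (Ideal.span {ϖ}) n c = 0 := by
    intro n
    rw [← mk_completionRep, Ideal.Quotient.eq_zero_iff_mem, Ideal.span_singleton_pow,
      Ideal.mem_span_singleton]
  simp only [h]
  exact ⟨fun h n => by rw [h, map_zero], fun h => AdicCompletion.ext_evalₐ fun n => by
    rw [h, map_zero]⟩

theorem completionRep_succ {ϖ : R} (c : completionAt ϖ) (n : ℕ) :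
    ϖ ^ n ∣ completionRep c (n + 1) - completionRep c n :=
  mk_span_pow_eq_iff.1 ((mk_completionRep_succ c n).trans (mk_completionRep c n).symm)

theorem completionRep_of_le {ϖ : R} (c : completionAt ϖ) {m n : ℕ} (h : m ≤ n) :
    ϖ ^ m ∣ completionRep c n - completionRep c m := by
  induction n, h using Nat.le_induction with
  | base => simp
  | succ n hn ih =>
    rw [← sub_add_sub_cancel]
    exact dvd_add ((pow_dvd_pow _ hn).trans (completionRep_succ c n)) ih

theorem pow_dvd_or_pow_dvd_of_pow_add_dvd_mul [IsDomain R] {ϖ : R} (hϖ : Prime ϖ) (m l : ℕ)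
    {a b : R} (h : ϖ ^ (m + l) ∣ a * b) : ϖ ^ m ∣ a ∨ ϖ ^ l ∣ b := by
  match m, l with
  | 0, _ => simp
  | _, 0 => simp
  | m + 1, l + 1 =>
    rcases hϖ.dvd_or_dvd ((dvd_pow_self ϖ (by omega)).trans h) with ⟨a', rfl⟩ | ⟨b', rfl⟩
    · rw [show m + 1 + (l + 1) = m + (l + 1) + 1 by ring, pow_succ', mul_assoc,
        mul_dvd_mul_iff_left hϖ.ne_zero] at h
      refine (pow_dvd_or_pow_dvd_of_pow_add_dvd_mul hϖ m (l + 1) h).imp_left fun h => ?_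
      rw [pow_succ']
      exact mul_dvd_mul_left _ h
    · rw [show m + 1 + (l + 1) = m + 1 + l + 1 by ring, pow_succ', mul_left_comm,
        mul_dvd_mul_iff_left hϖ.ne_zero] at h
      refine (pow_dvd_or_pow_dvd_of_pow_add_dvd_mul hϖ (m + 1) l h).imp_right fun h => ?_
      rw [pow_succ' ϖ l]
      exact mul_dvd_mul_left _ h
termination_by m + l

/-- If c is nonzero modulo ϖ ^ m and d modulo ϖ ^ l, the representatives at the common level m + l
still witness this, and their product cannot be divisible by ϖ ^ (m + l). -/
theorem completion_mul_eq_zero [IsDomain R] {ϖ : R} (hϖ : Prime ϖ) {c d : completionAt ϖ}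
    (h : c * d = 0) : c = 0 ∨ d = 0 := by
  have hcd : ∀ n, ϖ ^ n ∣ completionRep c n * completionRep d n := by
    intro n
    have := (completion_eq_zero_iff _).1 h n
    have h2 : ϖ ^ n ∣ completionRep (c * d) n - completionRep c n * completionRep d n := by
      rw [← mk_span_pow_eq_iff]
      simp [mk_completionRep]
    exact (dvd_sub_right this).1 h2
  by_contra! hne
  obtain ⟨m, hm⟩ := not_forall.1 (mt (completion_eq_zero_iff c).2 hne.1)
  obtain ⟨l, hl⟩ := not_forall.1 (mt (completion_eq_zero_iff d).2 hne.2)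
  have hm' : ¬ ϖ ^ m ∣ completionRep c (m + l) := fun h' =>
    hm ((dvd_sub_right h').1 (completionRep_of_le c (Nat.le_add_right m l)))
  have hl' : ¬ ϖ ^ l ∣ completionRep d (m + l) := fun h' =>
    hl ((dvd_sub_right h').1 (completionRep_of_le d (Nat.le_add_left l m)))
  exact (pow_dvd_or_pow_dvd_of_pow_add_dvd_mul hϖ m l (hcd (m + l))).elim hm' hl'

theorem tateModule_pow_smul_add {ϖ : R} (x : tateModule ϖ M) (m j : ℕ) :
    ϖ ^ m • x.1 (j + m) = x.1 j := by
  induction m with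
  | zero => simp
  | succ m ih => rw [pow_succ, mul_smul, ← add_assoc, x.2.2, ih]

theorem exists_tateModule_apply_eq {ϖ : R} (hM : Function.Surjective fun x : M => ϖ • x) {n : ℕ}
    {x : M} (hx : ϖ ^ n • x = 0) : ∃ e : tateModule ϖ M, e.1 n = x := by
  choose g hg using hM
  let y : ℕ → M := fun j => Nat.rec x (fun _ z => g z) j
  have hy : ∀ j, ϖ • y (j + 1) = y j := fun j => hg (y j)
  have hy' : ∀ j, ϖ ^ j • y j = x := by
    intro j
    induction j with
    | zero => simp [y]
    | succ j ih => rw [pow_succ, mul_smul, hy, ih]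
  -- The chain of successive divisions starts with x at index 0; multiplying by ϖ ^ n shifts it, so
  -- that x sits at index n and ϖ ^ n • x = 0 at index 0.
  refine ⟨⟨fun j => ϖ ^ n • y j, hx, fun j => ?_⟩, hy' n⟩
  rw [smul_comm, hy]

theorem tateModule_sum_smul_apply {ι : Type*} [Fintype ι] {ϖ : R} (c : ι → completionAt ϖ)
    (e : ι → tateModule ϖ M) (n : ℕ) {r : ι → R}
    (hr : ∀ i, Ideal.Quotient.mk (Ideal.span {ϖ} ^ n) (r i) =
      AdicCompletion.evalₐ (Ideal.span {ϖ}) n (c i)) :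
    (∑ i, c i • e i).1 n = ∑ i, r i • (e i).1 n := by
  rw [AddSubmonoidClass.coe_finsetSum, Finset.sum_apply]
  exact Finset.sum_congr rfl fun i _ => tateModule.smul_apply _ _ _ (hr i)

section

variable {ι : Type*} [Fintype ι] {ϖ : R} {e : ι → tateModule ϖ M}

/-- Multiplying a relation at level n + 1 by ϖ ^ n gives one at level 1, so every coefficient is
divisible by ϖ; dividing by ϖ leaves a relation at level n. -/
theorem tateModule_dvd_of_sum_eq_zero
    (hind : ∀ r : ι → R, ∑ i, r i • (e i).1 1 = 0 → ∀ i, ϖ ∣ r i) (n : ℕ) (r : ι → R)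
    (h : ∑ i, r i • (e i).1 n = 0) (i : ι) : ϖ ^ n ∣ r i := by
  induction n generalizing r i with
  | zero => simp
  | succ n ih =>
    have h1 : ∀ i, ϖ ∣ r i := hind r (by
      have := congrArg (ϖ ^ n • ·) h
      simp only [Finset.smul_sum, smul_zero, smul_comm (ϖ ^ n)] at this
      simpa only [add_comm n 1, tateModule_pow_smul_add] using this)
    choose s hs using h1
    have h2 := ih s (by
      rw [← h]
      refine Finset.sum_congr rfl fun i _ => ?_
      rw [hs, mul_comm, mul_smul, (e i).2.2]) i
    rw [hs, pow_succ']
    exact mul_dvd_mul_left _ h2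

theorem tateModule_exists_sum_eq
    (hspan : ∀ x : M, ϖ • x = 0 → ∃ r : ι → R, x = ∑ i, r i • (e i).1 1) (n : ℕ) (x : M)
    (hx : ϖ ^ n • x = 0) : ∃ r : ι → R, x = ∑ i, r i • (e i).1 n := by
  induction n generalizing x with
  | zero => exact ⟨0, by simpa using hx⟩
  | succ n ih =>
    obtain ⟨r, hr⟩ := hspan (ϖ ^ n • x) (by rw [← mul_smul, ← pow_succ', hx])
    obtain ⟨s, hs⟩ := ih (x - ∑ i, r i • (e i).1 (n + 1)) (by
      rw [smul_sub, hr, Finset.smul_sum, sub_eq_zero]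
      refine Finset.sum_congr rfl fun i _ => ?_
      rw [smul_comm, add_comm n 1, tateModule_pow_smul_add])
    refine ⟨fun i => r i + ϖ * s i, ?_⟩
    rw [← sub_eq_zero, ← sub_eq_zero.2 hs]
    simp only [add_smul, Finset.sum_add_distrib, mul_comm ϖ, mul_smul, (e _).2.2]
    abel

/-- Elements of the Tate module whose entries at level one form a basis of `M[ϖ]` over `R ⧸ (ϖ)`
form a basis of the Tate module. -/
def tateModuleBasis
    (hind : ∀ r : ι → R, ∑ i, r i • (e i).1 1 = 0 → ∀ i, ϖ ∣ r i)
    (hspan : ∀ x : M, ϖ • x = 0 → ∃ r : ι → R, x = ∑ i, r i • (e i).1 1) :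
    Module.Basis ι (completionAt ϖ) (tateModule ϖ M) :=
  Module.Basis.mk (v := e)
    (Fintype.linearIndependent_iff.2 fun c hc i => (completion_eq_zero_iff _).2 fun n => by
      refine tateModule_dvd_of_sum_eq_zero hind n (fun i => completionRep (c i) n) ?_ i
      rw [← tateModule_sum_smul_apply c e n fun i => mk_completionRep (c i) n, hc]
      rfl)
    (by
      rintro x -
      choose r hr using fun n =>
        tateModule_exists_sum_eq hspan n (x.1 n) (tateModule_pow_smul x n)
      -- Coordinates at successive levels agree modulo ϖ ^ n by independence, hence glue to elements
      -- of the completion.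
      have hcomp : ∀ i n, ϖ ^ n ∣ r (n + 1) i - r n i := by
        intro i n
        refine tateModule_dvd_of_sum_eq_zero hind n (fun i => r (n + 1) i - r n i) ?_ i
        simp only [sub_smul, Finset.sum_sub_distrib]
        rw [← hr, ← x.2.2 n, hr, Finset.smul_sum, sub_eq_zero]
        refine Finset.sum_congr rfl fun i _ => ?_
        rw [smul_comm, (e i).2.2]
      choose c hc using fun i => exists_completion_of_compatible (fun n => r n i) (hcomp i)
      have hx : x = ∑ i, c i • e i := by
        ext n
        rw [tateModule_sum_smul_apply c e n fun i => hc i n, ← hr]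
      rw [hx]
      exact Submodule.sum_mem _ fun i _ => Submodule.smul_mem _ _
        (Submodule.subset_span (Set.mem_range_self i)))

end

/-- The ϖ-torsion is a vector space over the residue field, whose dimension is read off from its
cardinality; a basis of it lifts by divisibility. -/
theorem exists_tateModule_basis {ϖ : R} (hmax : (Ideal.span {ϖ}).IsMaximal)
    [Finite (R ⧸ Ideal.span {ϖ})]
    (hM : Function.Surjective fun x : M => ϖ • x) (d : ℕ)
    (hcard : Nat.card (Submodule.torsionBy R M ϖ) = Nat.card (R ⧸ Ideal.span {ϖ}) ^ d) :
    Nonempty (Module.Basis (Fin d) (completionAt ϖ) (tateModule ϖ M)) := by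
  let := Ideal.Quotient.field (Ideal.span {ϖ})
  let : Module (R ⧸ Ideal.span {ϖ}) (Submodule.torsionBy R M ϖ) :=
    (Submodule.torsionBy_isTorsionBy (R := R) (M := M) ϖ).module
  have hsmul : ∀ (r : R) (x : Submodule.torsionBy R M ϖ),
      Ideal.Quotient.mk (Ideal.span {ϖ}) r • x = r • x := fun r x => rfl
  have : Finite (Submodule.torsionBy R M ϖ) := Nat.finite_of_card_ne_zero (by
    rw [hcard]; exact pow_ne_zero _ Nat.card_pos.ne')
  have hfr : Module.finrank (R ⧸ Ideal.span {ϖ}) (Submodule.torsionBy R M ϖ) = d := by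
    rw [Module.natCard_eq_pow_finrank (K := R ⧸ Ideal.span {ϖ})] at hcard
    exact Nat.pow_right_injective (Finite.one_lt_card) hcard
  let b := Module.finBasisOfFinrankEq _ _ hfr
  choose e he using fun i => exists_tateModule_apply_eq (n := 1) hM (x := (b i : M))
    (by rw [pow_one]; exact (b i).2)
  have hsum : ∀ r : Fin d → R, ∑ i, r i • (e i).1 1 =
      ((∑ i, Ideal.Quotient.mk (Ideal.span {ϖ}) (r i) • b i : Submodule.torsionBy R M ϖ) : M) := by
    intro r
    rw [AddSubmonoidClass.coe_finsetSum]
    exact Finset.sum_congr rfl fun i _ => by rw [he, hsmul]; rfl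
  refine ⟨tateModuleBasis (e := e) (fun r hr i => ?_) fun x hx => ?_⟩
  · rw [hsum, ZeroMemClass.coe_eq_zero] at hr
    have := Fintype.linearIndependent_iff.1 b.linearIndependent _ hr i
    rwa [Ideal.Quotient.eq_zero_iff_mem, Ideal.mem_span_singleton] at this
  · choose r hr using fun i => Ideal.Quotient.mk_surjective (b.repr ⟨x, hx⟩ i)
    refine ⟨r, ?_⟩
    rw [hsum]
    simp only [hr, b.sum_repr]

end TateBasis

/-! ### The matrix of τ ^ n: descent of its trace and determinant to k[X], and the degree of the
trace. -/

section FrobeniusMatrix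

variable {k : Type*} [Field k] [Fintype k] {L : Type*} [Field L] [Algebra k L]

theorem mem_range_algebraMap_of_pow_card_eq {c : L} (hc : c ^ Fintype.card k = c) :
    c ∈ (algebraMap k L).range := by
  have h : (X ^ Fintype.card k - X : k[X]) = ∏ a : k, (X - C a) := by
    refine (prod_multiset_X_sub_C_of_monic_of_roots_card_eq (monic_X_pow_sub ?_) ?_).symm.trans ?_
    · rw [degree_X]
      exact_mod_cast Fintype.one_lt_card (α := k)
    · rw [FiniteField.roots_X_pow_card_sub_X,
        FiniteField.X_pow_card_sub_X_natDegree_eq k Fintype.one_lt_card]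
      rfl
    · rw [FiniteField.roots_X_pow_card_sub_X]
      rfl
  have h' := congrArg (aeval c) h
  rw [map_sub, map_pow, aeval_X, hc, sub_self, map_prod, eq_comm, Finset.prod_eq_zero_iff] at h'
  obtain ⟨a, -, ha⟩ := h'
  exact ⟨a, (sub_eq_zero.1 (by simpa using ha)).symm⟩

variable (k L) in
/-- The `q`-power map on the coefficients of a polynomial. -/
def frobCoeff : L[X] →+* L[X] := mapRingHom (FiniteField.frobeniusAlgHom k L).toRingHom

theorem coeff_frobCoeff (f : L[X]) (i : ℕ) : (frobCoeff k L f).coeff i =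
    f.coeff i ^ Fintype.card k := by
  simp [frobCoeff]

theorem exists_map_eq_of_frobCoeff_eq {f : L[X]} (hf : frobCoeff k L f = f) :
    ∃ g : k[X], g.map (algebraMap k L) = f := by
  have : f ∈ lifts (algebraMap k L) := (lifts_iff_coeff_lifts f).2 fun i =>
    mem_range_algebraMap_of_pow_card_eq (by rw [← coeff_frobCoeff, hf])
  exact (mem_lifts f).1 this

variable (k) in
/-- The matrix with `(τ, τ²) = M (1, τ)` when `T = s + τ - s ^ (q - 1) τ²`. -/
def stepMat (s : L) : Matrix (Fin 2) (Fin 2) L[X] :=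
  !![0, 1; C (-s ^ (Fintype.card k - 1))⁻¹ * (X - C s), -C (-s ^ (Fintype.card k - 1))⁻¹]

variable (k) in
/-- The matrix with `(τ ^ i, τ ^ (i + 1)) = M (1, τ)` when `T = t + τ - t ^ (q - 1) τ²`. -/
def frobMat (t : L) : ℕ → Matrix (Fin 2) (Fin 2) L[X]
  | 0 => 1
  | i + 1 => stepMat k (t ^ Fintype.card k ^ i) * frobMat t i

theorem frobMat_succ_zero (t : L) (i : ℕ) (j : Fin 2) :
    frobMat k t (i + 1) 0 j = frobMat k t i 1 j := by
  simp [frobMat, stepMat, Matrix.mul_apply, Fin.sum_univ_two]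

theorem frobMat_succ_one (t : L) (i : ℕ) (j : Fin 2) :
    frobMat k t (i + 1) 1 j = C (-(t ^ Fintype.card k ^ i) ^ (Fintype.card k - 1))⁻¹ *
      ((X - C (t ^ Fintype.card k ^ i)) * frobMat k t i 0 j - frobMat k t i 1 j) := by
  rw [frobMat, stepMat, Matrix.mul_apply, Fin.sum_univ_two]
  simp only [Matrix.of_apply, Matrix.cons_val_zero, Matrix.cons_val_one]
  ring

theorem map_stepMat {L' : Type*} [Field L'] [Algebra k L'] (h : L →+* L') (s : L) :
    (mapRingHom h).mapMatrix (stepMat k s) = stepMat k (h s) := by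
  ext1 i j
  rw [RingHom.mapMatrix_apply, Matrix.map_apply]
  fin_cases i <;> fin_cases j <;> simp [stepMat]

theorem map_frobMat {L' : Type*} [Field L'] [Algebra k L'] (h : L →+* L') (t : L) (i : ℕ) :
    (mapRingHom h).mapMatrix (frobMat k t i) = frobMat k (h t) i := by
  induction i with
  | zero => simp [frobMat]
  | succ i ih => rw [frobMat, map_mul, ih, map_stepMat, map_pow, frobMat]

/-- The matrix is a product of step matrices at t, t ^ q, t ^ (q ^ 2), …; twisting shifts all of
them by one, which leaves room for a step at t on the right. -/
theorem frobCoeff_frobMat_mul_stepMat (t : L) (i : ℕ) :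
    (frobCoeff k L).mapMatrix (frobMat k t i) * stepMat k t = frobMat k t (i + 1) := by
  induction i with
  | zero => simp [frobMat]
  | succ i ih =>
    rw [frobMat, map_mul, mul_assoc, ih, frobCoeff, map_stepMat]
    conv_rhs => rw [frobMat]
    congr 2
    simp [pow_succ, pow_mul]

theorem det_stepMat_ne_zero {t : L} (ht : t ≠ 0) : (stepMat k t).det ≠ 0 := by
  have h : (C (-t ^ (Fintype.card k - 1))⁻¹ : L[X]) ≠ 0 :=
    C_ne_zero.2 (inv_ne_zero (neg_ne_zero.2 (pow_ne_zero _ ht)))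
  rw [Matrix.det_fin_two]
  simp only [stepMat, Matrix.of_apply, Matrix.cons_val_zero, Matrix.cons_val_one, zero_mul, one_mul,
    zero_sub, Matrix.cons_val', Matrix.cons_val_fin_one]
  exact neg_ne_zero.2 (mul_ne_zero h (X_sub_C_ne_zero t))

section

variable {t : L} {n : ℕ} (ht : t ≠ 0) (hn : t ^ Fintype.card k ^ n = t)

include hn

theorem frobCoeff_frobMat_mul_comm :
    (frobCoeff k L).mapMatrix (frobMat k t n) * stepMat k t = stepMat k t * frobMat k t n := by
  rw [frobCoeff_frobMat_mul_stepMat, frobMat, hn]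

include ht

/-- The twisted matrix is conjugate to the original by the step matrix. The adjugate replaces the
inverse, at the cost of a factor det that is cancelled at the end. -/
theorem frobCoeff_trace_frobMat :
    frobCoeff k L (frobMat k t n).trace = (frobMat k t n).trace := by
  have h := congrArg (fun M => (M * (stepMat k t).adjugate).trace) (frobCoeff_frobMat_mul_comm hn)
  beta_reduce at h
  rw [mul_assoc, Matrix.mul_adjugate,
    Matrix.trace_mul_comm (stepMat k t * _), ← mul_assoc, Matrix.adjugate_mul,
    Matrix.mul_smul, mul_one, Matrix.smul_mul, one_mul, Matrix.trace_smul, Matrix.trace_smul,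
    smul_eq_mul, smul_eq_mul] at h
  rw [AddMonoidHom.map_trace]
  exact mul_left_cancel₀ (det_stepMat_ne_zero ht) h

theorem frobCoeff_det_frobMat :
    frobCoeff k L (frobMat k t n).det = (frobMat k t n).det := by
  have h := congrArg Matrix.det (frobCoeff_frobMat_mul_comm hn)
  rw [Matrix.det_mul, Matrix.det_mul, mul_comm] at h
  rw [RingHom.map_det]
  exact mul_left_cancel₀ (det_stepMat_ne_zero ht) h

end

/-- Two steps multiply the diagonal top terms by X. The bounds on all four entries are proved
together; the stricter one for entry (0, 1) keeps it from disturbing the top coefficient of entry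
(1, 1). -/
theorem coeff_frobMat (t : L) (m : ℕ) :
    ((frobMat k t (2 * m) 0 0).coeff m = ∏ i ∈ Finset.range m,
        (-(t ^ Fintype.card k ^ (2 * i)) ^ (Fintype.card k - 1))⁻¹ ∧
      ∀ j, m < j → (frobMat k t (2 * m) 0 0).coeff j = 0) ∧
    (∀ j, m ≤ j → (frobMat k t (2 * m) 0 1).coeff j = 0) ∧
    (∀ j, m < j → (frobMat k t (2 * m) 1 0).coeff j = 0) ∧
    ((frobMat k t (2 * m) 1 1).coeff m = ∏ i ∈ Finset.range m,
        (-(t ^ Fintype.card k ^ (2 * i + 1)) ^ (Fintype.card k - 1))⁻¹ ∧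
      ∀ j, m < j → (frobMat k t (2 * m) 1 1).coeff j = 0) := by
  induction m with
  | zero =>
    have h0 : ∀ j, 0 < j → (1 : L[X]).coeff j = 0 := fun j hj => by
      rw [coeff_one, if_neg hj.ne']
    simp +contextual [frobMat, h0]
  | succ m ih =>
    obtain ⟨⟨h1, h1'⟩, h2, h3, h4, h4'⟩ := ih
    have key : ∀ p r : L[X], ∀ s c : L, ∀ j, (C c * ((X - C s) * p - r)).coeff (j + 1) =
        c * (p.coeff j - s * p.coeff (j + 1) - r.coeff (j + 1)) := fun p r s c j => by
      rw [coeff_C_mul, coeff_sub, sub_mul, coeff_sub, coeff_X_mul, coeff_C_mul]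
    have e0 : ∀ j, frobMat k t (2 * (m + 1)) 0 j = frobMat k t (2 * m + 1) 1 j := fun j =>
      frobMat_succ_zero t (2 * m + 1) j
    have e1 : ∀ j, frobMat k t (2 * (m + 1)) 1 j =
        C (-(t ^ Fintype.card k ^ (2 * m + 1)) ^ (Fintype.card k - 1))⁻¹ *
          ((X - C (t ^ Fintype.card k ^ (2 * m + 1))) * frobMat k t (2 * m) 1 j -
            frobMat k t (2 * (m + 1)) 0 j) := fun j => by
      rw [e0, ← frobMat_succ_zero t (2 * m) j]
      exact frobMat_succ_one t (2 * m + 1) j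
    have g1 : (frobMat k t (2 * (m + 1)) 0 0).coeff (m + 1) = ∏ i ∈ Finset.range (m + 1),
        (-(t ^ Fintype.card k ^ (2 * i)) ^ (Fintype.card k - 1))⁻¹ := by
      rw [e0, frobMat_succ_one, key, h1, h1' _ (Nat.lt_succ_self m), h3 _ (Nat.lt_succ_self m),
        Finset.prod_range_succ]
      ring
    have g1' : ∀ j, m + 1 < j → (frobMat k t (2 * (m + 1)) 0 0).coeff j = 0 := by
      intro j hj
      obtain ⟨j, rfl⟩ := Nat.exists_eq_add_of_lt hj
      rw [e0, frobMat_succ_one, key, h1' _ (by omega), h1' _ (by omega), h3 _ (by omega)]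
      ring
    have g2 : ∀ j, m + 1 ≤ j → (frobMat k t (2 * (m + 1)) 0 1).coeff j = 0 := by
      intro j hj
      obtain ⟨j, rfl⟩ := Nat.exists_eq_add_of_le' hj
      rw [e0, frobMat_succ_one, ← add_assoc, key, h2 _ (by omega), h2 _ (by omega),
        h4' _ (by omega)]
      ring
    refine ⟨⟨g1, g1'⟩, g2, fun j hj => ?_, ?_, fun j hj => ?_⟩
    · obtain ⟨j, rfl⟩ := Nat.exists_eq_add_of_lt hj
      rw [e1, key, h3 _ (by omega), h3 _ (by omega), g1' _ (by omega)]
      ring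
    · rw [e1, key, h4, h4' _ (Nat.lt_succ_self m), g2 _ le_rfl, Finset.prod_range_succ]
      ring
    · obtain ⟨j, rfl⟩ := Nat.exists_eq_add_of_lt hj
      rw [e1, key, h4' _ (by omega), h4' _ (by omega), g2 _ (by omega)]
      ring

theorem prod_add_prod_ne_zero (hq : Fintype.card k ≡ 1 [MOD 4]) {t : L} (ht : t ≠ 0) {m : ℕ}
    (hm : t ^ Fintype.card k ^ (2 * m) = t) :
    (∏ i ∈ Finset.range m, (-(t ^ Fintype.card k ^ (2 * i)) ^ (Fintype.card k - 1))⁻¹) +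
      ∏ i ∈ Finset.range m, (-(t ^ Fintype.card k ^ (2 * i + 1)) ^ (Fintype.card k - 1))⁻¹ ≠ 0 := by
  have hq0 : ((Fintype.card k : ℕ) : L) = 0 := card_cast_eq_zero
  have hq1 : 1 < Fintype.card k := Fintype.one_lt_card
  set q := Fintype.card k
  set s := ∏ i ∈ Finset.range m, t ^ q ^ (2 * i) with hs
  have hs0 : s ≠ 0 := Finset.prod_ne_zero_iff.2 fun i _ => pow_ne_zero _ ht
  have hsq : s ^ q ^ 2 = s := by
    -- Raising to the power q ^ 2 permutes the factors of s cyclically; the extra factor t expresses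
    -- this by splitting a product of m + 1 terms at either end.
    have h1 : s ^ q ^ 2 * t = s * t := by
      have h2 : ∀ i, (t ^ q ^ (2 * i)) ^ q ^ 2 = t ^ q ^ (2 * (i + 1)) := fun i => by
        rw [← pow_mul, ← pow_add]; rfl
      have := (Finset.prod_range_succ' (fun i => t ^ q ^ (2 * i)) m).symm.trans
        (Finset.prod_range_succ (fun i => t ^ q ^ (2 * i)) m)
      rw [hm, mul_zero, pow_zero, pow_one] at this
      rw [hs, ← Finset.prod_pow, Finset.prod_congr rfl fun i _ => h2 i]
      exact this
    exact mul_right_cancel₀ ht h1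
  have hsq' : ∏ i ∈ Finset.range m, t ^ q ^ (2 * i + 1) = s ^ q := by
    rw [hs, ← Finset.prod_pow]
    exact Finset.prod_congr rfl fun i _ => by rw [pow_succ q, pow_mul]
  have h2 : (2 : L) ≠ 0 := by
    intro h2
    obtain ⟨j, hj⟩ : ∃ j, q = 2 * j + 1 := ⟨q / 2, by have := hq; unfold Nat.ModEq at this; omega⟩
    rw [hj] at hq0
    simp [h2] at hq0
  have hneg : ∀ g : ℕ → L, ∏ i ∈ Finset.range m, (-(g i) ^ (q - 1))⁻¹ =
      (-1) ^ m * ((∏ i ∈ Finset.range m, g i) ^ (q - 1))⁻¹ := by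
    intro g
    rw [Finset.prod_inv_distrib, Finset.prod_neg, Finset.card_range, mul_inv, Finset.prod_pow,
      ← inv_pow, inv_neg_one]
  rw [hneg, hneg, hsq', ← mul_add]
  refine mul_ne_zero (pow_ne_zero _ (neg_ne_zero.2 one_ne_zero)) fun h => ?_
  set w := s ^ (q - 1) with hw
  have hw0 : w ≠ 0 := pow_ne_zero _ hs0
  have hwq : (s ^ q) ^ (q - 1) = w ^ q := by rw [hw, ← pow_mul, ← pow_mul, mul_comm]
  rw [hwq, add_eq_zero_iff_eq_neg, ← inv_neg, inv_inj] at h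
  -- This is s ^ (q ^ 2 - 1) = 1.
  have hw1 : w ^ q * w = 1 := by
    have : w ^ q * w * s = s := by
      rw [← pow_succ, hw, ← pow_mul, ← pow_succ]
      convert hsq using 2
      obtain ⟨r, hr⟩ := Nat.exists_eq_add_of_lt hq1
      rw [hr]
      simp
      ring
    exact mul_right_cancel₀ hs0 (this.trans (one_mul s).symm)
  -- The vanishing sum says w ^ q = -w, so w ^ q * w = 1 becomes w ^ 2 = -1. As q - 1 is divisible
  -- by 4, this gives w ^ q = w.
  have hw2 : w ^ 2 = -1 := by linear_combination w * h - hw1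
  obtain ⟨j, hj⟩ : ∃ j, q = 4 * j + 1 := ⟨q / 4, by have := hq; unfold Nat.ModEq at this; omega⟩
  have hw3 : w ^ q = w := by
    rw [hj, pow_succ, show 4 * j = 2 * (2 * j) by ring, pow_mul, hw2, pow_mul]
    simp
  rw [hw3] at h
  exact mul_ne_zero h2 hw0 (by linear_combination h)

theorem degree_trace_frobMat (hq : Fintype.card k ≡ 1 [MOD 4]) {t : L} (ht : t ≠ 0) {m : ℕ}
    (hm : t ^ Fintype.card k ^ (2 * m) = t) : (frobMat k t (2 * m)).trace.degree = m := by
  obtain ⟨⟨h1, h1'⟩, -, -, h4, h4'⟩ := coeff_frobMat (k := k) t m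
  rw [Matrix.trace_fin_two]
  refine degree_eq_of_le_of_coeff_ne_zero ((degree_le_iff_coeff_zero _ _).2 fun j hj => ?_) ?_
  · rw [Nat.cast_lt] at hj
    rw [coeff_add, h1' j hj, h4' j hj, add_zero]
  · rw [coeff_add, h1, h4]
    exact prod_add_prod_ne_zero hq ht hm

end FrobeniusMatrix

/-! ### Cayley–Hamilton for Frobenius, as an identity of operators. -/

section FrobeniusRelation

variable {k : Type*} [Field k] [Fintype k] {L : Type*} [Field L] [Algebra k L]

variable (k) in
/-- Right multiplication on the `L`-vector space of `k`-linear endomorphisms of `L`. -/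
def rightMul (g : Module.End k L) : Module.End L (Module.End k L) where
  toFun e := e * g
  map_add' _ _ := add_mul _ _ _
  map_smul' _ _ := rfl

theorem rightMul_apply (g e : Module.End k L) : rightMul k g e = e * g := rfl

theorem aeval_rightMul_mul {g π : Module.End k L} (h : π * g = g * π) (f : L[X])
    (e : Module.End k L) : aeval (rightMul k g) f e * π = aeval (rightMul k g) f (e * π) := by
  induction f using Polynomial.induction_on' generalizing e with
  | add p r hp hr => simp [hp, hr, add_mul]
  | monomial n a =>
    simp only [aeval_monomial, Module.algebraMap_end_eq_smul_id, Module.End.mul_apply,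
      LinearMap.smul_apply, LinearMap.id_apply]
    rw [smul_mul_assoc]
    congr 1
    induction n generalizing e with
    | zero => simp
    | succ n ih =>
      rw [pow_succ, Module.End.mul_apply, ih, Module.End.mul_apply, rightMul_apply, rightMul_apply,
        mul_assoc, mul_assoc, h]

/-- Coefficients in k commute with k-linear maps, so for them the action through right
multiplication is composition with φ_f. -/
theorem aeval_rightMul_map (g : Module.End k L) (f : k[X]) (e : Module.End k L) :
    aeval (rightMul k g) (f.map (algebraMap k L)) e = e * aeval g f := by
  induction f using Polynomial.induction_on' generalizing e with
  | add p r hp hr =>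
    rw [Polynomial.map_add, map_add, LinearMap.add_apply, hp, hr, map_add, mul_add]
  | monomial n a =>
    simp only [map_monomial, aeval_monomial, Module.algebraMap_end_eq_smul_id, Module.End.mul_apply,
      LinearMap.smul_apply, LinearMap.id_apply, algebraMap_smul]
    rw [smul_mul_assoc, mul_smul_comm, ← Module.End.one_eq_id, one_mul]
    congr 1
    induction n generalizing e with
    | zero => simp
    | succ n ih =>
      rw [pow_succ, Module.End.mul_apply, ih, rightMul_apply, pow_succ', mul_assoc]

theorem coe_frobeniusAlgHom_pow {B : Type*} [CommRing B] [Algebra k B] (i : ℕ) (x : B) :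
    (FiniteField.frobeniusAlgHom k B ^ i : B →ₐ[k] B) x = x ^ Fintype.card k ^ i := by
  rw [AlgHom.coe_pow, FiniteField.coe_frobeniusAlgHom, pow_iterate]

theorem frobeniusAlgHom_pow_apply (i : ℕ) (x : L) :
    ((FiniteField.frobeniusAlgHom k L).toLinearMap ^ i) x = x ^ Fintype.card k ^ i := by
  induction i with
  | zero => simp
  | succ i ih => rw [pow_succ', Module.End.mul_apply, ih, pow_succ, pow_mul]; rfl

theorem frobeniusAlgHom_pow_mul_drinfeldOp (t : L) (i : ℕ) :
    (FiniteField.frobeniusAlgHom k L).toLinearMap ^ i * drinfeldOp k t =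
      t ^ Fintype.card k ^ i • (FiniteField.frobeniusAlgHom k L).toLinearMap ^ i +
        (FiniteField.frobeniusAlgHom k L).toLinearMap ^ (i + 1) +
        (-(t ^ Fintype.card k ^ i) ^ (Fintype.card k - 1)) •
          (FiniteField.frobeniusAlgHom k L).toLinearMap ^ (i + 2) := by
  ext x
  simp only [Module.End.mul_apply, LinearMap.add_apply, LinearMap.smul_apply, drinfeldOp_apply]
  simp only [frobeniusAlgHom_pow_apply, smul_eq_mul]
  rw [← coe_frobeniusAlgHom_pow i (_ - _)]
  simp only [map_add, map_sub, map_mul, coe_frobeniusAlgHom_pow, map_pow]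
  ring

/-- This justifies the recursion for `frobMat`: the formula for τ ^ i φ_T is solved for τ ^ (i + 2),
and the factor φ_T on the right is the action of X. -/
theorem frobeniusAlgHom_pow_eq {t : L} (ht : t ≠ 0) (i : ℕ) (j : Fin 2) :
    (FiniteField.frobeniusAlgHom k L).toLinearMap ^ (i + j) =
      aeval (rightMul k (drinfeldOp k t)) (frobMat k t i j 0) 1 +
        aeval (rightMul k (drinfeldOp k t)) (frobMat k t i j 1)
          (FiniteField.frobeniusAlgHom k L).toLinearMap := by
  induction i generalizing j with
  | zero =>
    rw [frobMat]
    fin_cases j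
    · change _ = aeval (rightMul k (drinfeldOp k t)) ((1 : Matrix (Fin 2) (Fin 2) L[X]) 0 0) 1 +
        aeval (rightMul k (drinfeldOp k t)) ((1 : Matrix (Fin 2) (Fin 2) L[X]) 0 1) _
      simp
    · change _ = aeval (rightMul k (drinfeldOp k t)) ((1 : Matrix (Fin 2) (Fin 2) L[X]) 1 0) 1 +
        aeval (rightMul k (drinfeldOp k t)) ((1 : Matrix (Fin 2) (Fin 2) L[X]) 1 1) _
      simp
  | succ i ih =>
    fin_cases j
    · simpa [frobMat_succ_zero] using ih 1
    · have h0 := ih 0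
      have h1 := ih 1
      have h := frobeniusAlgHom_pow_mul_drinfeldOp (k := k) t i
      have hc : (-(t ^ Fintype.card k ^ i) ^ (Fintype.card k - 1)) ≠ 0 :=
        neg_ne_zero.2 (pow_ne_zero _ (pow_ne_zero _ ht))
      set τ := (FiniteField.frobeniusAlgHom k L).toLinearMap
      set c := (-(t ^ Fintype.card k ^ i) ^ (Fintype.card k - 1))
      have h' : τ ^ (i + 2) = c⁻¹ • (τ ^ i * drinfeldOp k t - t ^ Fintype.card k ^ i • τ ^ i -
          τ ^ (i + 1)) := by
        rw [h, add_assoc, add_sub_cancel_left, add_sub_cancel_left, inv_smul_smul₀ hc]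
      have hX : ∀ e, e * drinfeldOp k t = aeval (rightMul k (drinfeldOp k t)) (X : L[X]) e := fun e => by
        rw [aeval_X, rightMul_apply]
      have hC : ∀ (c : L) (e : Module.End k L), c • e =
          aeval (rightMul k (drinfeldOp k t)) (C c) e := fun c e => by simp
      simp only [Fin.val_zero, Fin.val_one, Fin.isValue, add_zero, Fin.mk_one] at h0 h1 ⊢
      rw [add_assoc, one_add_one_eq_two, h', hC, hX, hC, frobMat_succ_one, frobMat_succ_one, h0, h1]
      simp only [map_add, map_sub, map_mul, Module.End.mul_apply, LinearMap.sub_apply,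
        mul_sub, sub_mul]
      abel

theorem frobenius_relation {t : L} (ht : t ≠ 0) {n : ℕ} (hn : t ^ Fintype.card k ^ n = t) {a b : k[X]}
    (ha : a.map (algebraMap k L) = (frobMat k t n).trace)
    (hb : b.map (algebraMap k L) = (frobMat k t n).det) (x : L) :
    (x ^ Fintype.card k ^ n) ^ Fintype.card k ^ n -
      aeval (drinfeldOp k t) a (x ^ Fintype.card k ^ n) + aeval (drinfeldOp k t) b x = 0 := by
  have h0 := frobeniusAlgHom_pow_eq (k := k) ht n 0
  have h1 := frobeniusAlgHom_pow_eq (k := k) ht n 1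
  simp only [Fin.val_zero, Fin.val_one, Fin.isValue, add_zero] at h0 h1
  set τ := (FiniteField.frobeniusAlgHom k L).toLinearMap with hτ
  have hcomm' : ∀ f : k[X], τ ^ n * aeval (drinfeldOp k t) f = aeval (drinfeldOp k t) f * τ ^ n := by
    intro f
    ext y
    have := map_aeval_drinfeldOp (FiniteField.frobeniusAlgHom k L ^ n : L →ₐ[k] L) t f y
    simp only [coe_frobeniusAlgHom_pow, hn] at this
    simpa only [Module.End.mul_apply, hτ, frobeniusAlgHom_pow_apply] using this
  have hcomm : τ ^ n * drinfeldOp k t = drinfeldOp k t * τ ^ n := by simpa using hcomm' X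
  set D := drinfeldOp k t
  set A := aeval (rightMul k D) (frobMat k t n 0 0)
  set B := aeval (rightMul k D) (frobMat k t n 0 1)
  have h2 : τ ^ n * τ ^ n = A (τ ^ n) + B (τ ^ (n + 1)) := by
    have h : τ ^ n * τ ^ n = (A 1 + B τ) * τ ^ n := by rw [← h0]
    rw [h, add_mul, aeval_rightMul_mul hcomm, aeval_rightMul_mul hcomm, one_mul, ← pow_succ']
  -- This eliminates τ, turning the two expansions of τ ^ n and τ ^ (n + 1) into a quadratic
  -- relation for τ ^ n alone.
  have hB : B τ = τ ^ n - A 1 := by rw [h0]; abel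
  have h3 : τ ^ n * τ ^ n = aeval (rightMul k D) (frobMat k t n).trace (τ ^ n) -
      aeval (rightMul k D) (frobMat k t n).det 1 := by
    rw [h2, h1, Matrix.trace_fin_two, Matrix.det_fin_two]
    have e1 : B (aeval (rightMul k D) (frobMat k t n 1 1) τ) =
        aeval (rightMul k D) (frobMat k t n 1 1) (τ ^ n - A 1) := by
      rw [← hB, ← Module.End.mul_apply, ← map_mul, mul_comm, map_mul, Module.End.mul_apply]
    rw [map_add B, e1]
    simp only [map_add, map_sub, map_mul, Module.End.mul_apply, LinearMap.sub_apply,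
      LinearMap.add_apply]
    have e2 : A (aeval (rightMul k D) (frobMat k t n 1 1) 1) =
        aeval (rightMul k D) (frobMat k t n 1 1) (A 1) := by
      rw [← Module.End.mul_apply, ← map_mul, mul_comm, map_mul, Module.End.mul_apply]
    rw [e2]
    abel
  rw [← ha, ← hb, aeval_rightMul_map, aeval_rightMul_map, one_mul] at h3
  rw [hcomm'] at h3
  have h4 := congrArg (fun e : Module.End k L => e x) h3
  simp only [Module.End.mul_apply, LinearMap.sub_apply] at h4
  simp only [hτ, frobeniusAlgHom_pow_apply] at h4
  rw [h4]
  abel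

end FrobeniusRelation

/-! ### The relation for the residue field of `𝔭` and all its extensions. -/

section

variable {k : Type u} [Field k] [Fintype k]

theorem natCard_quotient_span {f : k[X]} (hf : f ≠ 0) :
    Nat.card (k[X] ⧸ Ideal.span {f}) = Fintype.card k ^ f.natDegree := by
  have : Module.Finite k (k[X] ⧸ Ideal.span {f}) :=
    (AdjoinRoot.powerBasis hf).finite
  rw [Module.natCard_eq_pow_finrank (K := k), finrank_quotient_span_eq_natDegree,
    Nat.card_eq_fintype_card]

/-- The polynomials a and b come from the finite field `AdjoinRoot 𝔭`, but the relation is needed on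
larger fields, namely residue fields of the integral closure in `Fsep k`. There the matrix is the
image of the one over `AdjoinRoot 𝔭`. -/
theorem exists_frobenius_relation (hq : Fintype.card k ≡ 1 [MOD 4]) {𝔭 : k[X]} (h𝔭 : Irreducible 𝔭)
    (hX : ¬ Associated 𝔭 X) {m : ℕ} (hm : 𝔭.natDegree = 2 * m) :
    ∃ a b : k[X], a.degree = m ∧ ∀ (κ : Type u) [Field κ] [Algebra k κ] (t : κ), aeval t 𝔭 = 0 →
      ∀ x : κ, (x ^ Fintype.card k ^ (2 * m)) ^ Fintype.card k ^ (2 * m) -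
        aeval (drinfeldOp k t) a (x ^ Fintype.card k ^ (2 * m)) +
          aeval (drinfeldOp k t) b x = 0 := by
  have : Fact (Irreducible 𝔭) := ⟨h𝔭⟩
  set s : AdjoinRoot 𝔭 := AdjoinRoot.root 𝔭
  have hs0 : s ≠ 0 := by
    intro h
    have h' : AdjoinRoot.mk 𝔭 X = 0 := by rwa [AdjoinRoot.mk_X]
    rw [AdjoinRoot.mk_eq_zero] at h'
    exact hX ((h𝔭.dvd_irreducible_iff_associated irreducible_X).1 h')
  have hcard : Nat.card (AdjoinRoot 𝔭) = Fintype.card k ^ (2 * m) := by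
    rw [← hm]; exact natCard_quotient_span h𝔭.ne_zero
  have hs : s ^ Fintype.card k ^ (2 * m) = s := by
    have : Finite (AdjoinRoot 𝔭) := Nat.finite_of_card_ne_zero (by
      rw [hcard]; exact pow_ne_zero _ Fintype.card_ne_zero)
    have := Fintype.ofFinite (AdjoinRoot 𝔭)
    rw [← hcard, Nat.card_eq_fintype_card, FiniteField.pow_card]
  obtain ⟨a, ha⟩ := exists_map_eq_of_frobCoeff_eq (frobCoeff_trace_frobMat hs0 hs)
  obtain ⟨b, hb⟩ := exists_map_eq_of_frobCoeff_eq (frobCoeff_det_frobMat hs0 hs)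
  refine ⟨a, b, ?_, fun κ _ _ t ht x => ?_⟩
  · rw [← degree_map a (algebraMap k (AdjoinRoot 𝔭)), ha]
    exact degree_trace_frobMat hq hs0 hs
  · let h : AdjoinRoot 𝔭 →ₐ[k] κ := AdjoinRoot.liftAlgHom 𝔭 (Algebra.ofId k κ) t (by
      rw [aeval_def] at ht; exact ht)
    have hst : h s = t := AdjoinRoot.liftAlgHom_root ..
    have hmap : ∀ f : k[X], f.map (algebraMap k κ) =
        mapRingHom (h : AdjoinRoot 𝔭 →+* κ) (f.map (algebraMap k (AdjoinRoot 𝔭))) := fun f => by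
      rw [coe_mapRingHom, Polynomial.map_map, AlgHom.comp_algebraMap]
    have hM := map_frobMat (k := k) (h : AdjoinRoot 𝔭 →+* κ) s (2 * m)
    rw [RingHom.coe_coe, hst] at hM
    refine frobenius_relation ?_ ?_ ?_ ?_ x
    · rw [← hst]; exact (map_ne_zero h).2 hs0
    · rw [← hst, ← map_pow, hs]
    · rw [hmap, ha, ← hM, AddMonoidHom.map_trace]
      rfl
    · rw [hmap, hb, ← hM, RingHom.map_det]

end

/-! ### Reduction of torsion points at a prime not above T. -/

section Reduction

variable {k : Type u} [Field k] [Fintype k]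

theorem aeval_sepT (f : k[X]) : aeval (sepT k) f = algebraMap k[X] (Fsep k) f := by
  have h : sepT k = algebraMap k[X] (Fsep k) X := by
    rw [IsScalarTower.algebraMap_apply k[X] (RatFunc k) (Fsep k), RatFunc.algebraMap_X]
    rfl
  rw [h, aeval_algebraMap_apply, aeval_X_left_apply]

theorem sepT_ne_zero : sepT k ≠ 0 :=
  (_root_.map_ne_zero _).2 RatFunc.X_ne_zero

theorem algebraMap_Fsep_injective : Function.Injective (algebraMap k[X] (Fsep k)) := by
  rw [IsScalarTower.algebraMap_eq k[X] (RatFunc k) (Fsep k)]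
  exact (algebraMap (RatFunc k) (Fsep k)).injective.comp (RatFunc.algebraMap_injective k)

variable {κ : Type*} [Field κ] [Algebra k κ] (r : integralClosure k[X] (Fsep k) →ₐ[k] κ)

/-- The image of the indeterminate under a reduction map. -/
def redT : κ := r (algebraMap k[X] _ X)

theorem aeval_redT (f : k[X]) : aeval (redT r) f = r (algebraMap k[X] _ f) := by
  rw [redT, aeval_algHom_apply, aeval_algebraMap_apply, aeval_X_left_apply]

variable (hr : redT r ≠ 0)

/-- The graph of the extension of the reduction map `r` to the ring obtained by inverting `T`. -/
def redGraph : Subalgebra k (Fsep k × κ) where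
  carrier := {p | ∃ (N : ℕ) (z : integralClosure k[X] (Fsep k)),
    sepT k ^ N * p.1 = z ∧ redT r ^ N * p.2 = r z}
  mul_mem' := by
    rintro p p' ⟨N, z, h1, h2⟩ ⟨N', z', h1', h2'⟩
    refine ⟨N + N', z * z', ?_, ?_⟩
    · rw [Prod.fst_mul, pow_add, mul_mul_mul_comm, h1, h1']; rfl
    · rw [Prod.snd_mul, pow_add, mul_mul_mul_comm, h2, h2', map_mul]
  add_mem' := by
    rintro p p' ⟨N, z, h1, h2⟩ ⟨N', z', h1', h2'⟩
    refine ⟨N + N', algebraMap k[X] _ X ^ N' * z + algebraMap k[X] _ X ^ N * z', ?_, ?_⟩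
    · have hT : ((algebraMap k[X] (integralClosure k[X] (Fsep k)) X :
          integralClosure k[X] (Fsep k)) : Fsep k) = sepT k := by
        rw [← aeval_X (R := k) (sepT k), aeval_sepT]; rfl
      rw [Subalgebra.coe_add, Subalgebra.coe_mul, Subalgebra.coe_mul, Subalgebra.coe_pow,
        Subalgebra.coe_pow, hT, ← h1, ← h1', Prod.fst_add]
      ring
    · rw [map_add, map_mul, map_mul, map_pow, map_pow, ← h2, ← h2', Prod.snd_add, redT]
      ring
  algebraMap_mem' := fun c => ⟨0, algebraMap k _ c, by simp, by simp⟩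

variable {r}

theorem mem_redGraph_of_integral (z : integralClosure k[X] (Fsep k)) :
    ((z : Fsep k), r z) ∈ redGraph r := ⟨0, z, by simp, by simp⟩

theorem sepT_redT_mem : (sepT k, redT r) ∈ redGraph r := by
  have := mem_redGraph_of_integral (r := r) (algebraMap k[X] _ X)
  rwa [← aeval_redT, aeval_X, Subalgebra.coe_algebraMap, ← aeval_sepT, aeval_X] at this

theorem aeval_drinfeldOp_mem_redGraph {x : Fsep k} {y : κ} (h : (x, y) ∈ redGraph r) (f : k[X]) :
    (aeval (drinfeldOp k (sepT k)) f x, aeval (drinfeldOp k (redT r)) f y) ∈ redGraph r := by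
  have h1 := map_aeval_drinfeldOp (redGraph r).val ⟨_, sepT_redT_mem⟩ f ⟨_, h⟩
  have h2 := map_aeval_drinfeldOp (AlgHom.fst k (Fsep k) κ) (sepT k, redT r) f (x, y)
  have h3 := map_aeval_drinfeldOp (AlgHom.snd k (Fsep k) κ) (sepT k, redT r) f (x, y)
  have h4 : aeval (drinfeldOp k (sepT k, redT r)) f (x, y) ∈ redGraph r := by
    change _ = aeval (drinfeldOp k (sepT k, redT r)) f (x, y) at h1
    rw [← h1]
    exact Subtype.property _
  have h5 : aeval (drinfeldOp k (sepT k, redT r)) f (x, y) =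
      (aeval (drinfeldOp k (sepT k)) f x, aeval (drinfeldOp k (redT r)) f y) := Prod.ext h2 h3
  rwa [h5] at h4

theorem galois_mem_redGraph {σ : Gal(Fsep k/RatFunc k)} {N : ℕ}
    (hσ : ∀ z, r (galRestrict k[X] (RatFunc k) (Fsep k) (integralClosure k[X] (Fsep k)) σ z) =
      r z ^ N) (hN : redT r ^ N = redT r) {x : Fsep k} {y : κ} (h : (x, y) ∈ redGraph r) :
    (σ x, y ^ N) ∈ redGraph r := by
  obtain ⟨M, z, h1, h2⟩ := h
  refine ⟨M, galRestrict k[X] (RatFunc k) (Fsep k) (integralClosure k[X] (Fsep k)) σ z, ?_, ?_⟩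
  · have := algebraMap_galRestrict_apply k[X] (K := RatFunc k) (L := Fsep k)
      (B := integralClosure k[X] (Fsep k)) σ z
    change ((galRestrict k[X] (RatFunc k) (Fsep k) (integralClosure k[X] (Fsep k)) σ z :
      integralClosure k[X] (Fsep k)) : Fsep k) = σ (z : Fsep k) at this
    rw [this, ← h1, map_mul, map_pow]
    congr 2
    exact (σ.commutes _).symm
  · rw [hσ, ← h2, mul_pow, ← pow_mul, mul_comm M, pow_mul, hN]

include hr

/-- The graph is single-valued because T has nonzero reduction. -/
theorem redGraph_snd_eq {x : Fsep k} {y y' : κ} (h : (x, y) ∈ redGraph r)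
    (h' : (x, y') ∈ redGraph r) : y = y' := by
  obtain ⟨N, z, h1, h2⟩ := (redGraph r).sub_mem h h'
  simp only [Prod.mk_sub_mk, sub_self, mul_zero] at h1 h2
  have : z = 0 := Subtype.ext h1.symm
  rw [this, map_zero] at h2
  exact sub_eq_zero.1 ((mul_eq_zero.1 h2).resolve_left (pow_ne_zero _ hr))

theorem exists_mem_redGraph {c : k[X]} (hc : c ≠ 0) {x : Fsep k}
    (hx : aeval (drinfeldOp k (sepT k)) c x = 0) : ∃ y, (x, y) ∈ redGraph r := by
  obtain ⟨-, e, M, hlead⟩ := natDegree_drinfeldPoly (k := k) (t := (X : k[X])) X_ne_zero hc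
  have hT : algebraMap k[X] (Fsep k) X = sepT k := by rw [← aeval_sepT, aeval_X]
  have h := isIntegral_leadingCoeff_smul (R := k[X]) (drinfeldPoly k X c) x (by
    rw [aeval_drinfeldPoly, hT, hx])
  rw [hlead] at h
  have hint : IsIntegral k[X] (sepT k ^ M * x) := by
    -- Sign and constant are units of k[X], so only a power of T is needed to make x integral.
    have hu : IsUnit (algebraMap k k[X] c.leadingCoeff * (-1) ^ e) :=
      ((IsUnit.mk0 _ (leadingCoeff_ne_zero.2 hc)).map _).mul (isUnit_one.neg.pow _)
    obtain ⟨v, hv⟩ := hu.exists_left_inv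
    have := h.smul v
    rw [smul_smul, ← mul_assoc, ← mul_assoc, mul_assoc v, hv, one_mul, Algebra.smul_def, map_pow, hT]
      at this
    exact this
  refine ⟨(redT r ^ M)⁻¹ * r ⟨_, hint⟩, M, ⟨_, hint⟩, rfl, ?_⟩
  rw [mul_inv_cancel_left₀ (pow_ne_zero _ hr)]

/-- Were x nonzero, dividing 0 = φ_c(x) = c x + x² s by x would give c + x s = 0, whose reduction
says that c vanishes at the image of T. -/
theorem eq_zero_of_mem_redGraph {c : k[X]} (hc : aeval (redT r) c ≠ 0) {x : Fsep k}
    (hx : aeval (drinfeldOp k (sepT k)) c x = 0) (h : (x, 0) ∈ redGraph r) : x = 0 := by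
  by_contra hx0
  obtain ⟨s, hs⟩ := exists_aeval_drinfeldOp_eq (k := k) (B := redGraph r) ⟨_, sepT_redT_mem⟩ c ⟨_, h⟩
  have hs' := congrArg (redGraph r).val hs
  rw [map_aeval_drinfeldOp, map_add, map_mul, map_mul, map_pow, ← aeval_algHom_apply] at hs'
  have hs1 := congrArg (AlgHom.fst k (Fsep k) κ) hs'
  rw [map_aeval_drinfeldOp, map_add, map_mul, map_mul, map_pow, ← aeval_algHom_apply] at hs1
  change aeval (drinfeldOp k (sepT k)) c x = aeval (sepT k) c * x + x ^ 2 * s.1.1 at hs1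
  have h0 : aeval (sepT k) c + x * s.1.1 = 0 := by
    rw [hx] at hs1
    exact mul_right_cancel₀ hx0 (by linear_combination -hs1)
  have hmem : (aeval (sepT k) c + x * s.1.1, aeval (redT r) c + 0 * s.1.2) ∈ redGraph r := by
    have e1 : (aeval (sepT k) c, aeval (redT r) c) ∈ redGraph r := by
      rw [aeval_sepT, aeval_redT]
      exact mem_redGraph_of_integral (r := r) (algebraMap k[X] _ c)
    have e2 : (x * s.1.1, 0 * s.1.2) ∈ redGraph r := (redGraph r).mul_mem h s.2
    exact (redGraph r).add_mem e1 e2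
  rw [h0, zero_mul, add_zero] at hmem
  exact hc (redGraph_snd_eq hr hmem (redGraph r).zero_mem)

/-- The left side is c-torsion and reduces to the relation for the N-th power map, that is to zero;
injectivity of reduction finishes. -/
theorem galois_relation {σ : Gal(Fsep k/RatFunc k)} {N : ℕ}
    (hσ : ∀ z, r (galRestrict k[X] (RatFunc k) (Fsep k) (integralClosure k[X] (Fsep k)) σ z) =
      r z ^ N) (hN : redT r ^ N = redT r) {a b : k[X]}
    (hab : ∀ y : κ, (y ^ N) ^ N - aeval (drinfeldOp k (redT r)) a (y ^ N) +
      aeval (drinfeldOp k (redT r)) b y = 0) {c : k[X]} (hc : aeval (redT r) c ≠ 0) {x : Fsep k}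
    (hx : aeval (drinfeldOp k (sepT k)) c x = 0) :
    σ (σ x) - aeval (drinfeldOp k (sepT k)) a (σ x) + aeval (drinfeldOp k (sepT k)) b x = 0 := by
  have hc0 : c ≠ 0 := by rintro rfl; simp at hc
  obtain ⟨y, hy⟩ := exists_mem_redGraph hr hc0 hx
  have h1 := galois_mem_redGraph hσ hN hy
  have h2 := galois_mem_redGraph hσ hN h1
  refine eq_zero_of_mem_redGraph hr hc ?_ (hab y ▸ (redGraph r).add_mem ((redGraph r).sub_mem h2
    (aeval_drinfeldOp_mem_redGraph h1 a)) (aeval_drinfeldOp_mem_redGraph hy b))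
  have hcomm : ∀ (f : k[X]) (w : Fsep k), aeval (drinfeldOp k (sepT k)) c w = 0 →
      aeval (drinfeldOp k (sepT k)) c (aeval (drinfeldOp k (sepT k)) f w) = 0 := fun f w hw => by
    rw [← Module.End.mul_apply, ← map_mul, mul_comm, map_mul, Module.End.mul_apply, hw, map_zero]
  have hgal : ∀ w : Fsep k, aeval (drinfeldOp k (sepT k)) c w = 0 →
      aeval (drinfeldOp k (sepT k)) c (σ w) = 0 := fun w hw => by
    have := map_aeval_drinfeldOp (σ.toAlgHom.restrictScalars k) (sepT k) c w
    have hT : σ (sepT k) = sepT k := σ.commutes _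
    change σ (aeval (drinfeldOp k (sepT k)) c w) = aeval (drinfeldOp k (σ (sepT k))) c (σ w) at this
    rw [← hT, ← this, hw, map_zero]
  rw [map_add, map_sub, hgal _ (hgal _ hx), hcomm _ _ (hgal _ hx), hcomm _ _ hx]
  simp

/-- If σ acted as φ_f on the c-torsion, the reductions would be q ^ (2 deg c) distinct roots of X ^
(q ^ n) - φ_f(X), which has smaller degree. This polynomial would thus be zero, and derivative and
degree then contradict each other. -/
theorem galois_not_scalar {σ : Gal(Fsep k/RatFunc k)} {n : ℕ}
    (hσ : ∀ z, r (galRestrict k[X] (RatFunc k) (Fsep k) (integralClosure k[X] (Fsep k)) σ z) =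
      r z ^ Fintype.card k ^ n) (hn : redT r ^ Fintype.card k ^ n = redT r)
    (hn0 : n ≠ 0) (hker : ∀ f : k[X], f ≠ 0 → aeval (redT r) f = 0 → n ≤ f.natDegree)
    {c : k[X]} (hc : aeval (redT r) c ≠ 0) (hdeg : n < 2 * c.natDegree) {f : k[X]}
    (hf : f.degree < c.natDegree) :
    ∃ x, aeval (drinfeldOp k (sepT k)) c x = 0 ∧ σ x ≠ aeval (drinfeldOp k (sepT k)) f x := by
  classical
  by_contra! hall
  have hc0 : c ≠ 0 := by rintro rfl; simp at hc
  have hq : 1 < Fintype.card k := Fintype.one_lt_card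
  have hred : ∀ x : Fsep k, ∃ y, aeval (drinfeldOp k (sepT k)) c x = 0 → (x, y) ∈ redGraph r := by
    intro x
    by_cases hx : aeval (drinfeldOp k (sepT k)) c x = 0
    · obtain ⟨y, hy⟩ := exists_mem_redGraph hr hc0 hx
      exact ⟨y, fun _ => hy⟩
    · exact ⟨0, fun h => absurd h hx⟩
  choose ρ hρ using hred
  set G : κ[X] := X ^ Fintype.card k ^ n - drinfeldPoly k (redT r) f with hG
  have hroot : ∀ x, aeval (drinfeldOp k (sepT k)) c x = 0 → eval (ρ x) G = 0 := by
    intro x hx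
    rw [hG, eval_sub, eval_pow, eval_X, eval_drinfeldPoly, sub_eq_zero]
    refine redGraph_snd_eq hr (galois_mem_redGraph hσ hn (hρ x hx)) ?_
    rw [hall x hx]
    exact aeval_drinfeldOp_mem_redGraph (hρ x hx) f
  have hG0 : G = 0 := by
    by_contra hne
    have hle := Set.ncard_le_ncard_of_injOn
      (s := {x | aeval (drinfeldOp k (sepT k)) c x = 0}) (t := (G.roots.toFinset : Set κ)) ρ
      (fun x hx => by
        rw [Finset.mem_coe, Multiset.mem_toFinset, mem_roots hne]
        exact hroot x hx)
      (fun x hx x' hx' he => by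
        have := (redGraph r).sub_mem (hρ x hx) (hρ x' hx')
        rw [Prod.mk_sub_mk, he, sub_self] at this
        exact sub_eq_zero.1 (eq_zero_of_mem_redGraph hr hc (by
          rw [map_sub, hx, hx', sub_zero]) this))
      (Finset.finite_toSet _)
    have : IsSepClosed (Fsep k) := (Fsep.instIsSepClosure k).sep_closed
    rw [ncard_ker_aeval_drinfeldOp sepT_ne_zero (by
      rw [aeval_sepT]; exact (map_ne_zero_iff _ algebraMap_Fsep_injective).2 hc0),
      Set.ncard_coe_finset] at hle
    have hlt : G.degree < (Fintype.card k ^ (2 * c.natDegree) : ℕ) := by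
      refine (degree_sub_le _ _).trans_lt (max_lt ?_ (degree_drinfeldPoly_lt hr hf))
      rw [degree_X_pow, Nat.cast_lt]
      exact Nat.pow_lt_pow_right hq hdeg
    have := (Multiset.toFinset_card_le _).trans (card_roots' G)
    rw [degree_eq_natDegree hne, Nat.cast_lt] at hlt
    omega
  rw [hG, sub_eq_zero] at hG0
  -- The derivative shows that f vanishes at the image of T, so n ≤ deg f; comparing degrees gives n
  -- = 2 deg f, impossible for n > 0.
  have hder := congrArg derivative hG0
  rw [derivative_drinfeldPoly, derivative_X_pow, Nat.cast_pow, card_cast_eq_zero, zero_pow hn0,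
    C_0, zero_mul, eq_comm, C_eq_zero] at hder
  have hf0 : f ≠ 0 := by
    rintro rfl
    rw [drinfeldPoly, map_zero, LinearMap.zero_apply] at hG0
    exact pow_ne_zero _ X_ne_zero hG0
  have hle := hker f hf0 hder
  have hd := congrArg natDegree hG0
  rw [natDegree_X_pow, (natDegree_drinfeldPoly hr hf0).1] at hd
  have := Nat.pow_right_injective hq hd
  omega

end Reduction

/-! ### Existence of Frobenius elements. -/

section FrobeniusExists

variable {k : Type u} [Field k] [Fintype k]

/-- The decomposition group of a prime Q above `𝔭` surjects onto the automorphisms of the residue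
extension, by the profinite form of the theorem. It requires a continuous action on the discrete
integral closure whose ring of invariants is k[T]. -/
theorem exists_isFrobenius {𝔭 : k[X]} (h𝔭 : Irreducible 𝔭) :
    ∃ σ : Gal(Fsep k/RatFunc k), IsFrobenius 𝔭 σ := by
  let O := integralClosure k[X] (Fsep k)
  have hmax : (Ideal.span {𝔭}).IsMaximal := PrincipalIdealRing.isMaximal_of_irreducible h𝔭
  have hinj : Function.Injective (algebraMap k[X] O) := fun a b hab =>
    algebraMap_Fsep_injective (congrArg (algebraMap O (Fsep k)) hab)
  have : FaithfulSMul k[X] O := (faithfulSMul_iff_algebraMap_injective _ _).2 hinj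
  obtain ⟨Q, hQ, hQo⟩ := Ideal.exists_maximal_ideal_liesOver_of_isIntegral (S := O) (Ideal.span {𝔭})
  have hQp : Q.IsPrime := hQ.isPrime
  let : MulSemiringAction Gal(Fsep k/RatFunc k) O :=
    IsIntegralClosure.MulSemiringAction k[X] (RatFunc k) (Fsep k) O
  have hsmul : ∀ (σ : Gal(Fsep k/RatFunc k)) (z : O),
      σ • z = galRestrict k[X] (RatFunc k) (Fsep k) O σ z := fun _ _ => rfl
  have hcoe : ∀ (σ : Gal(Fsep k/RatFunc k)) (z : O),
      ((σ • z : O) : Fsep k) = σ (z : Fsep k) := fun σ z =>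
    algebraMap_galRestrict_apply k[X] (K := RatFunc k) (L := Fsep k) (B := O) σ z
  have : SMulCommClass Gal(Fsep k/RatFunc k) k[X] O := ⟨fun σ f z => by
    rw [hsmul, hsmul, map_smul]⟩
  have : IsGalois (RatFunc k) (Fsep k) := IsSepClosure.isGalois
  let : TopologicalSpace O := ⊥
  have : DiscreteTopology O := ⟨rfl⟩
  have : ContinuousSMul Gal(Fsep k/RatFunc k) O :=
    continuousSMul_iff_stabilizer_isOpen.2 fun z : O => by
      have hz : (MulAction.stabilizer Gal(Fsep k/RatFunc k) z : Set Gal(Fsep k/RatFunc k)) =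
          MulAction.stabilizer Gal(Fsep k/RatFunc k) (z : Fsep k) := by
        ext σ
        simp only [SetLike.mem_coe, MulAction.mem_stabilizer_iff]
        rw [← Subtype.coe_inj, hcoe]
        rfl
      rw [hz]
      exact stabilizer_isOpen_of_isIntegral (K := RatFunc k) (z : Fsep k)
  have : Algebra.IsInvariant k[X] O Gal(Fsep k/RatFunc k) := ⟨fun z hz => by
    obtain ⟨w, hw⟩ := (InfiniteGalois.mem_range_algebraMap_iff_fixed (k := RatFunc k)
      (z : Fsep k)).2 fun σ => by rw [← hcoe, hz]
    have hint : IsIntegral k[X] w := by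
      rw [← isIntegral_algebraMap_iff (algebraMap (RatFunc k) (Fsep k)).injective, hw]
      exact z.2
    obtain ⟨f, rfl⟩ := IsIntegrallyClosed.algebraMap_eq_of_integral hint
    exact ⟨f, Subtype.ext hw⟩⟩
  let : Field (k[X] ⧸ Ideal.span {𝔭}) := Ideal.Quotient.field _
  let : Field (O ⧸ Q) := Ideal.Quotient.field _
  have hcard := natCard_quotient_span h𝔭.ne_zero
  have : Finite (k[X] ⧸ Ideal.span {𝔭}) := Nat.finite_of_card_ne_zero (by
    rw [hcard]; exact pow_ne_zero _ Fintype.card_ne_zero)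
  let := Fintype.ofFinite (k[X] ⧸ Ideal.span {𝔭})
  have : Algebra.IsIntegral (k[X] ⧸ Ideal.span {𝔭}) (O ⧸ Q) :=
    Ideal.Quotient.algebra_isIntegral_of_liesOver Q (Ideal.span {𝔭})
  have : Algebra.IsAlgebraic (k[X] ⧸ Ideal.span {𝔭}) (O ⧸ Q) :=
    Algebra.IsIntegral.isAlgebraic
  obtain ⟨σ, hσ⟩ := Ideal.Quotient.stabilizerHom_surjective_of_profinite
    (G := Gal(Fsep k/RatFunc k)) (Ideal.span {𝔭}) Q
    (FiniteField.frobeniusAlgEquivOfAlgebraic (k[X] ⧸ Ideal.span {𝔭}) (O ⧸ Q))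
  refine ⟨σ, Q, hQp, hQo, fun z => ?_⟩
  have h := DFunLike.congr_fun hσ (Ideal.Quotient.mk Q z)
  rw [← Ideal.Quotient.eq, ← hQo.over, Nat.card_eq_fintype_card, map_pow]
  exact h

end FrobeniusExists

/-- Comparison with Cayley–Hamilton makes (tr - a) M scalar. If tr ≠ a, this factor cancels from the
off-diagonal entries and from the difference of the diagonal ones. -/
theorem trace_eq_or_scalar {S V : Type*} [CommRing S] [AddCommGroup V] [Module S V]
    (hS : ∀ c d : S, c * d = 0 → c = 0 ∨ d = 0) (e : Module.Basis (Fin 2) S V) (f : Module.End S V)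
    (a b : S) (h : ∀ x, f (f x) - a • f x + b • x = 0) :
    LinearMap.trace S V f = a ∨ ∃ c : S, ∀ x, f x = c • x := by
  set M := LinearMap.toMatrix e e f with hM
  have hmat : M * M - a • M + b • (1 : Matrix (Fin 2) (Fin 2) S) = 0 := by
    rw [hM, ← LinearMap.toMatrix_mul, ← map_smul, ← LinearMap.toMatrix_one e, ← map_smul, ← map_sub,
      ← map_add, LinearEquiv.map_eq_zero_iff]
    exact LinearMap.ext h
  have hentry : ∀ i j, M i 0 * M 0 j + M i 1 * M 1 j - a * M i j +
      b * (1 : Matrix (Fin 2) (Fin 2) S) i j = 0 := fun i j => by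
    have := congrFun (congrFun hmat i) j
    simpa [Matrix.mul_apply, Fin.sum_univ_two] using this
  rw [LinearMap.trace_eq_matrix_trace S e, ← hM, Matrix.trace_fin_two, or_iff_not_imp_left]
  intro hne
  have hne' : M 0 0 + M 1 1 - a ≠ 0 := sub_ne_zero.2 hne
  have h00 := hentry 0 0
  have h01 := hentry 0 1
  have h10 := hentry 1 0
  have h11 := hentry 1 1
  rw [Matrix.one_apply_eq] at h00 h11
  rw [Matrix.one_apply_ne (by decide)] at h01 h10
  have e01 : M 0 1 = 0 := (hS (M 0 1) _ (by linear_combination h01)).resolve_right hne'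
  have e10 : M 1 0 = 0 := (hS (M 1 0) _ (by linear_combination h10)).resolve_right hne'
  have e00 : M 0 0 - M 1 1 = 0 := (hS _ _ (by
    linear_combination h00 - h11)).resolve_right hne'
  have hscal : M = M 0 0 • (1 : Matrix (Fin 2) (Fin 2) S) := by
    ext i j
    fin_cases i <;> fin_cases j
    · simp
    · simpa using e01
    · simpa using e10
    · simpa using (sub_eq_zero.1 e00).symm
  refine ⟨M 0 0, fun x => ?_⟩
  have hf : f = M 0 0 • (1 : Module.End S V) := by
    apply (LinearMap.toMatrix e e).injective
    rw [map_smul, LinearMap.toMatrix_one]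
    exact hscal
  conv_lhs => rw [hf]
  rfl

/-! ### The Galois action on Tate modules of φ, and the trace of Frobenius. -/

section Points

variable {k : Type u} [Field k] [Fintype k]

theorem smul_of_drinfeldPoints (f : k[X]) (x : Fsep k) :
    f • Module.AEval'.of (drinfeldT k) x =
      Module.AEval'.of (drinfeldT k) (aeval (drinfeldOp k (sepT k)) f x) :=
  (Module.AEval.of_aeval_smul (drinfeldT k) f x).symm

theorem galoisPoints_of (σ : Gal(Fsep k/RatFunc k)) (x : Fsep k) :
    galoisPoints k σ (Module.AEval'.of (drinfeldT k) x) = Module.AEval'.of (drinfeldT k) (σ x) :=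
  rfl

theorem aeval_sepT_ne_zero {f : k[X]} (hf : f ≠ 0) : aeval (sepT k) f ≠ 0 := by
  rw [aeval_sepT]
  exact (map_ne_zero_iff _ algebraMap_Fsep_injective).2 hf

instance : IsSepClosed (Fsep k) := (Fsep.instIsSepClosure k).sep_closed

theorem smul_drinfeldPoints_surjective {f : k[X]} (hf : f ≠ 0) :
    Function.Surjective fun x : drinfeldPoints k => f • x := by
  intro y
  obtain ⟨y, rfl⟩ := (Module.AEval'.of (drinfeldT k)).surjective y
  obtain ⟨x, rfl⟩ := aeval_drinfeldOp_surjective sepT_ne_zero (aeval_sepT_ne_zero hf) y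
  exact ⟨_, smul_of_drinfeldPoints f x⟩

theorem natCard_torsionBy_drinfeldPoints {f : k[X]} (hf : f ≠ 0) :
    Nat.card (Submodule.torsionBy k[X] (drinfeldPoints k) f) =
      Fintype.card k ^ (2 * f.natDegree) := by
  rw [← ncard_ker_aeval_drinfeldOp sepT_ne_zero (aeval_sepT_ne_zero hf), ← Nat.card_coe_set_eq]
  refine Nat.card_congr ((Module.AEval'.of (drinfeldT k)).toEquiv.symm.subtypeEquiv fun y => ?_)
  obtain ⟨y, rfl⟩ := (Module.AEval'.of (drinfeldT k)).surjective y
  rw [Submodule.mem_torsionBy_iff, smul_of_drinfeldPoints]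
  simp

theorem nonempty_basis_tateModule {ϖ : k[X]} (hϖ : Irreducible ϖ) :
    Nonempty (Module.Basis (Fin 2) (completionAt ϖ) (tateModule ϖ (drinfeldPoints k))) := by
  have hcard := natCard_quotient_span hϖ.ne_zero
  have : Finite (k[X] ⧸ Ideal.span {ϖ}) := Nat.finite_of_card_ne_zero (by
    rw [hcard]; exact pow_ne_zero _ Fintype.card_ne_zero)
  refine exists_tateModule_basis (PrincipalIdealRing.isMaximal_of_irreducible hϖ)
    (smul_drinfeldPoints_surjective hϖ.ne_zero) 2 ?_
  rw [natCard_torsionBy_drinfeldPoints hϖ.ne_zero, hcard, ← pow_mul, mul_comm]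

theorem algebraMap_completion_smul_apply {ϖ : k[X]} (f : k[X]) (x : tateModule ϖ (drinfeldPoints k))
    (n : ℕ) : (algebraMap k[X] (completionAt ϖ) f • x).1 n = f • x.1 n :=
  tateModule.smul_apply _ _ _ ((AdicCompletion.evalₐ (Ideal.span {ϖ}) n).commutes f).symm

theorem algebraMap_completion_injective {ϖ : k[X]} (hϖ : Irreducible ϖ) :
    Function.Injective (algebraMap k[X] (completionAt ϖ)) := by
  rw [injective_iff_map_eq_zero]
  intro f hf
  by_contra hf0
  have hdvd : ∀ n, ϖ ^ n ∣ f := fun n => by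
    have h := (AdicCompletion.evalₐ (Ideal.span {ϖ}) n).commutes f
    rw [hf, map_zero, Ideal.Quotient.algebraMap_eq, eq_comm, Ideal.Quotient.eq_zero_iff_mem,
      Ideal.span_singleton_pow, Ideal.mem_span_singleton] at h
    exact h
  have h := natDegree_le_of_dvd (hdvd (f.natDegree + 1)) hf0
  rw [natDegree_pow] at h
  have := hϖ.natDegree_pos
  nlinarith

theorem isFrobeniusTrace_of_relation {𝔭 : k[X]} (h𝔭 : Irreducible 𝔭) (hX : ¬ Associated 𝔭 X)
    {a b : k[X]} (hab : ∀ (κ : Type u) [Field κ] [Algebra k κ] (t : κ), aeval t 𝔭 = 0 →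
      ∀ x : κ, (x ^ Fintype.card k ^ 𝔭.natDegree) ^ Fintype.card k ^ 𝔭.natDegree -
        aeval (drinfeldOp k t) a (x ^ Fintype.card k ^ 𝔭.natDegree) +
          aeval (drinfeldOp k t) b x = 0) : IsFrobeniusTrace 𝔭 a := by
  rintro ϖ hϖ hne σ ⟨Q, hQ, hQo, hσ⟩
  have hmax : (Ideal.span {𝔭}).IsMaximal := PrincipalIdealRing.isMaximal_of_irreducible h𝔭
  have hQm : Q.IsMaximal := .of_liesOver_isMaximal Q (Ideal.span {𝔭})
  let : Field (integralClosure k[X] (Fsep k) ⧸ Q) := Ideal.Quotient.field Q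
  let r : integralClosure k[X] (Fsep k) →ₐ[k] integralClosure k[X] (Fsep k) ⧸ Q :=
    Ideal.Quotient.mkₐ k Q
  have hker : ∀ f : k[X], aeval (redT r) f = 0 ↔ 𝔭 ∣ f := by
    intro f
    rw [aeval_redT, ← Ideal.mem_span_singleton, hQo.over]
    exact Ideal.Quotient.eq_zero_iff_mem
  have hr : redT r ≠ 0 := by
    rw [← aeval_X (R := k) (redT r), Ne, hker]
    exact fun h => hX ((h𝔭.dvd_irreducible_iff_associated irreducible_X).1 h)
  have hcard : Nat.card (k[X] ⧸ Q.under k[X]) = Fintype.card k ^ 𝔭.natDegree := by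
    rw [← hQo.over, natCard_quotient_span h𝔭.ne_zero]
  have hσ' : ∀ z, r (galRestrict k[X] (RatFunc k) (Fsep k) (integralClosure k[X] (Fsep k)) σ z) =
      r z ^ Fintype.card k ^ 𝔭.natDegree := fun z => by
    rw [← hcard]
    exact hσ.mk_apply z
  have hn : redT r ^ Fintype.card k ^ 𝔭.natDegree = redT r := by
    have := hσ' (algebraMap k[X] _ X)
    rw [AlgEquiv.commutes] at this
    exact this.symm
  have hϖm : ∀ m, aeval (redT r) (ϖ ^ m) ≠ 0 := fun m => by
    rw [map_pow]
    refine pow_ne_zero _ ((hker ϖ).not.2 fun h => ?_)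
    exact hne ((h𝔭.dvd_irreducible_iff_associated hϖ).1 h).symm
  obtain ⟨e⟩ := nonempty_basis_tateModule hϖ
  have hrel : ∀ x, adicRep k ϖ σ (adicRep k ϖ σ x) -
      algebraMap k[X] (completionAt ϖ) a • adicRep k ϖ σ x +
        algebraMap k[X] (completionAt ϖ) b • x = 0 := by
    intro x
    ext n
    have hx := tateModule_pow_smul x n
    change galoisPoints k σ (galoisPoints k σ (x.1 n)) -
      (algebraMap k[X] (completionAt ϖ) a • adicRep k ϖ σ x).1 n +
        (algebraMap k[X] (completionAt ϖ) b • x).1 n = 0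
    rw [algebraMap_completion_smul_apply, algebraMap_completion_smul_apply]
    change galoisPoints k σ (galoisPoints k σ (x.1 n)) - a • galoisPoints k σ (x.1 n) +
      b • x.1 n = 0
    obtain ⟨y, hy⟩ := (Module.AEval'.of (drinfeldT k)).surjective (x.1 n)
    rw [← hy, smul_of_drinfeldPoints, LinearEquiv.map_eq_zero_iff] at hx
    rw [← hy, galoisPoints_of, galoisPoints_of, smul_of_drinfeldPoints, smul_of_drinfeldPoints,
      ← map_sub, ← map_add, LinearEquiv.map_eq_zero_iff]
    exact galois_relation hr hσ' hn (hab _ _ ((hker 𝔭).2 dvd_rfl)) (hϖm n) hx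
  have key := trace_eq_or_scalar (S := completionAt ϖ) (V := tateModule ϖ (drinfeldPoints k))
    (fun c d => completion_mul_eq_zero hϖ.prime) e (adicRep k ϖ σ)
    (algebraMap k[X] (completionAt ϖ) a) (algebraMap k[X] (completionAt ϖ) b) hrel
  refine key.resolve_right ?_
  rintro ⟨c, hc⟩
  -- Large enough that deg 𝔭 < 2 deg(ϖ ^ m), as the root count requires.
  set m := 𝔭.natDegree + 1 with hm
  have hpow : (ϖ ^ m).natDegree = m * ϖ.natDegree := natDegree_pow _ _
  have hϖd := hϖ.natDegree_pos
  -- A scalar in the completion acts on ϖ ^ m-torsion through its remainder modulo ϖ ^ m, whose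
  -- degree is below that of ϖ ^ m.
  obtain ⟨x, hx, hne⟩ := galois_not_scalar hr hσ' hn h𝔭.natDegree_pos.ne'
    (fun f hf hf0 => natDegree_le_of_dvd ((hker f).1 hf0) hf) (hϖm m) (by rw [hpow]; nlinarith)
    (f := completionRep c m % ϖ ^ m) (by
      rw [← degree_eq_natDegree (pow_ne_zero _ hϖ.ne_zero)]
      exact EuclideanDomain.mod_lt _ (pow_ne_zero _ hϖ.ne_zero))
  obtain ⟨w, hw⟩ := exists_tateModule_apply_eq (smul_drinfeldPoints_surjective hϖ.ne_zero)
    (n := m) (x := Module.AEval'.of (drinfeldT k) x) (by rw [smul_of_drinfeldPoints, hx, map_zero])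
  have h := congrArg (fun y => y.1 m) (hc w)
  change galoisPoints k σ (w.1 m) = (c • w).1 m at h
  rw [tateModule.smul_apply c w m (r := completionRep c m % ϖ ^ m) (by
    rw [← mk_completionRep, mk_span_pow_eq_iff, EuclideanDomain.mod_eq_sub_mul_div, sub_sub_cancel_left,
      dvd_neg]
    exact dvd_mul_right _ _), hw, galoisPoints_of, smul_of_drinfeldPoints] at h
  exact hne ((Module.AEval'.of (drinfeldT k)).injective h)

/-- One place and one Frobenius element suffice; λ = (T) is available since `𝔭` is not associated to
T. -/
theorem isFrobeniusTrace_unique {𝔭 : k[X]} (h𝔭 : Irreducible 𝔭) (hX : ¬ Associated 𝔭 X) {a a' : k[X]}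
    (ha : IsFrobeniusTrace 𝔭 a) (ha' : IsFrobeniusTrace 𝔭 a') : a = a' := by
  obtain ⟨σ, hσ⟩ := exists_isFrobenius h𝔭
  have hX' : ¬ Associated (X : k[X]) 𝔭 := fun h => hX h.symm
  exact algebraMap_completion_injective irreducible_X
    ((ha X irreducible_X hX' σ hσ).symm.trans (ha' X irreducible_X hX' σ hσ))

theorem frobeniusTrace_spec {𝔭 : k[X]} (h : ∃ a, IsFrobeniusTrace 𝔭 a) :
    IsFrobeniusTrace 𝔭 (frobeniusTrace 𝔭) := by
  rw [frobeniusTrace, dif_pos h]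
  exact h.choose_spec

end Points

end

theorem proposition2p1 (k : Type*) [Field k] [Fintype k] (hq : Fintype.card k ≡ 1 [MOD 4]) :
    (∀ (n : ℕ) (𝔭 : k[X]), Even n → Irreducible 𝔭 → ¬ Associated 𝔭 X → 𝔭.natDegree = n →
      (∃! a : k[X], IsFrobeniusTrace 𝔭 a) ∧
        IsFrobeniusTrace 𝔭 (frobeniusTrace 𝔭) ∧
        (frobeniusTrace 𝔭).degree = ((n / 2 : ℕ) : WithBot ℕ)) ∧
    (∀ (t : k[X]) (n : ℕ), Even n → 2 * t.natDegree < n → langTrotterCount t n = 0) := by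
  have main : ∀ (n : ℕ) (𝔭 : k[X]), Even n → Irreducible 𝔭 → ¬ Associated 𝔭 X → 𝔭.natDegree = n →
      (∃! a : k[X], IsFrobeniusTrace 𝔭 a) ∧
        IsFrobeniusTrace 𝔭 (frobeniusTrace 𝔭) ∧
        (frobeniusTrace 𝔭).degree = ((n / 2 : ℕ) : WithBot ℕ) := by
    rintro n 𝔭 hn h𝔭 hX rfl
    obtain ⟨m, hm⟩ := hn.exists_two_nsmul
    rw [smul_eq_mul] at hm
    obtain ⟨a, b, ha, hab⟩ := exists_frobenius_relation hq h𝔭 hX hm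
    rw [← hm] at hab
    have htr : IsFrobeniusTrace 𝔭 a := isFrobeniusTrace_of_relation h𝔭 hX hab
    have hspec := frobeniusTrace_spec ⟨a, htr⟩
    refine ⟨⟨a, htr, fun a' ha' => isFrobeniusTrace_unique h𝔭 hX ha' htr⟩, hspec, ?_⟩
    rw [isFrobeniusTrace_unique h𝔭 hX hspec htr, ha, hm, Nat.mul_div_cancel_left m two_pos]
  refine ⟨main, fun t n hn ht => ?_⟩
  rw [langTrotterCount, Set.encard_eq_zero, Set.eq_empty_iff_forall_notMem]
  rintro 𝔭 ⟨hmonic, hirr, hne, hdeg, htr⟩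
  obtain ⟨-, -, h⟩ := main n 𝔭 hn hirr
    (fun h => hne (eq_of_monic_of_associated hmonic monic_X h)) hdeg
  rw [htr] at h
  -- For t = 0 this equality reads n / 2 = 0, against 0 < n.
  have := natDegree_eq_of_degree_eq_some h
  obtain ⟨m, rfl⟩ := hn
  omega
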